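/- **Setting.** Let $M$ be a unital $*$-subalgebra of a full matrix algebra $M_\iota(\mathbb C)$ ($\iota$ a finite nonempty index set), with the normalized trace $\tau$ and $\langle x,y\rangle=\tau(x^*y)$. A symmetric quantum Markov semigroup on $M$ is a continuous semigroup $(P_t)_{t\ge 0}$ of unital completely positive linear maps on $M$ with $P_0=\mathrm{id}$ and $\tau(P_t(x)y)=\tau(xP_t(y))$. Its generator is $\mathcal Lx=\lim_{t\searrow0}\frac1t(x-P_tx)$, so $P_t=e^{-t\mathcal L}$, and $\Gamma(a,b)=\frac12\big(a^*\mathcal Lb+(\mathcal La)^*b-\mathcal L(a^*b)\big)$. Let $K\in\mathbb R$ and $N>0$, and read $\frac{1-e^{-2Kt}}{KN}$ as $\frac{2t}{N}$ if $K=0$. * $(P_t)$ satisfies $\mathrm{CBE}(K,N)$ if for all $n$, $x_1,\dots,x_n\in M$ and $t>0$, in the order of $M_n(M)$, $$[\Gamma(P_tx_j,P_tx_k)]_{j,k}\le e^{-2Kt}[P_t\Gamma(x_j,x_k)]_{j,k}-\tfrac{1-e^{-2Kt}}{KN}[(\mathcal LP_tx_j)^*(\mathcal LP_tx_k)]_{j,k}.$$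 * A Lindblad form of $\mathcal L$ consists of $v_1,\dots,v_d\in M_\iota(\mathbb C)$ (not necessarily in $M$) such that the families $(v_j)$ and $(v_j^*)$ agree up to a permutation and $\mathcal L=\sum_{j}\partial_j^\dagger\partial_j$ on $M$, where $\partial_j=[v_j,\cdot]$ and $\partial_j^\dagger=[v_j^*,\cdot]$. For an operator mean $\Lambda$ (in the sense of Kubo and Ando, on an infinite-dimensional complex Hilbert space, extended to finite-dimensional spaces through isometric embeddings) and $\rho\ge0$ let $\hat\rho=\Lambda(L(\rho),R(\rho))$, with $L(\rho),R(\rho)$ left and right multiplication by $\rho$, and let $\|\partial a\|_\rho^2=\sum_j\langle\partial_ja,\hat\rho\,\partial_ja\rangle$. A symmetric quantum Markov semigroup whose generator has a Lindblad form satisfies $\mathrm{GE}(K,N)$ for $\Lambda$ if for each of its Lindblad forms, all $t\ge0$, $a\in M$ and invertible positive $\rho\in M$ with $\tau(\rho)=1$, $$\|\partial P_ta\|_\rho^2\le e^{-2Kt}\|\partial a\|_{P_t\rho}^2-\tfrac{1-e^{-2Kt}}{KN}\,|\langle a,\mathcal LP_t\rho\rangle|^2.$$ It satisfies $\mathrm{CGE}(K,N)$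 for $\Lambda$ if $(P_t\otimes\mathrm{id}_{M_m(\mathbb C)})$ satisfies $\mathrm{GE}(K,N)$ for $\Lambda$ for all $m\ge1$. **Theorem.** 1. (Schur multipliers.) Let $n\ge1$, let $[a_{ij}]\in M_n(\mathbb C)$ and $P_t[x_{ij}]=[e^{-ta_{ij}}x_{ij}]$ on $M_n(\mathbb C)$. Then $(P_t)$ is a symmetric quantum Markov semigroup if and only if $a_{ii}=0$, $a_{ij}=a_{ji}\ge0$ for all $i,j$, and $\sum_{i,j}\overline{\alpha_i}\alpha_ja_{ij}\le0$ for all $\alpha\in\mathbb C^n$ with $\sum_j\alpha_j=0$. In this case there are a real Hilbert space $H$ of some finite dimension $d\ge 1$ and $a(1),\dots,a(n)\in H$ with $a_{ij}=\|a(i)-a(j)\|^2$ for all $i,j$; and for every such representation with $\dim H=d\ge1$, $(P_t)$ satisfies $\mathrm{CBE}(0,d)$, and $\mathrm{CGE}(0,d)$ for every operator mean. 2. (Herz–Schur multipliers.) Let $G$ be a finite group with left regular representation $\lambda$ on $\ell_2(G)$, and let $\mathbb C[G]=\mathrm{span}\{\lambda_g: g\in G\}\subseteq B(\ell_2(G))$.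 Let $\ell:G\to[0,\infty)$ be a conditionally negative definite length function, that is, $\ell(e)=0$, $\ell(g^{-1})=\ell(g)$ and $\sum_{g,h}\overline{\alpha_g}\alpha_h\ell(g^{-1}h)\le0$ for all $\alpha\in\mathbb C^G$ with $\sum_g\alpha_g=0$. Then $P_t\lambda_g=e^{-t\ell(g)}\lambda_g$ defines a symmetric quantum Markov semigroup on $\mathbb C[G]$. There are a real Hilbert space $H$ with $\dim H\le|G|-1$, an orthogonal representation $\pi$ of $G$ on $H$ and a map $b:G\to H$ such that $b(gh)=b(g)+\pi(g)b(h)$ and $\ell(g)=\|b(g)\|^2$ for all $g,h\in G$; and for every such cocycle $(H,\pi,b)$ with $\dim H=d$, $1\le d<\infty$, $(P_t)$ satisfies $\mathrm{CBE}(0,d)$, and $\mathrm{CGE}(0,d)$ for every operator mean. 3. (Cyclic groups.) For every even $n\ge2$ the word length $\ell(k)=\min\{k,n-k\}$, $0\le k\le n-1$, on $\mathbb Z_n$ is a conditionally negative definite length function, and the associated semigroup on $\mathbb C[\mathbb Z_n]$ satisfies $\mathrm{CBE}(0,n/2)$, and $\mathrm{CGE}(0,n/2)$ for every operator mean. 4.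 (Symmetric groups.) For every $n\ge2$ the Hamming length $\ell(\sigma)=\#\{j:\sigma(j)\ne j\}$ on $S_n$ is a conditionally negative definite length function, and the associated semigroup on $\mathbb C[S_n]$ satisfies $\mathrm{CBE}(0,d)$, and $\mathrm{CGE}(0,d)$ for every operator mean, with $d=\min\{|S_n|-1,n^2\}$. -/

import Mathlib

open Filter Topology
open scoped ComplexOrder MatrixOrder

noncomputable section

namespace QMarkov

set_option linter.unusedSectionVars false

/-! ### Operator means -/

section OperatorMeans

variable {𝓗 : Type*} [NormedAddCommGroup 𝓗] [InnerProductSpace ℂ 𝓗] [CompleteSpace 𝓗]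

/-- `A n ↘ A₀`: a decreasing sequence of operators that converges strongly to `A₀`. -/
def DecreasesTo (A : ℕ → 𝓗 →L[ℂ] 𝓗) (A₀ : 𝓗 →L[ℂ] 𝓗) : Prop :=
  Antitone A ∧ ∀ x : 𝓗, Tendsto (fun n => A n x) atTop (𝓝 (A₀ x))

/-- An operator mean in the sense of Kubo and Ando, a map
`Λ : B(𝓗)₊ × B(𝓗)₊ → B(𝓗)₊`. The underlying function is total; only its values on pairs of
positive operators are constrained and used. The order is the Loewner order. -/
structure OperatorMean (𝓗 : Type*) [NormedAddCommGroup 𝓗] [InnerProductSpace ℂ 𝓗]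
    [CompleteSpace 𝓗] where
  toFun : (𝓗 →L[ℂ] 𝓗) → (𝓗 →L[ℂ] 𝓗) → (𝓗 →L[ℂ] 𝓗)
  nonneg : ∀ A B, 0 ≤ A → 0 ≤ B → 0 ≤ toFun A B
  mono : ∀ A B C D, 0 ≤ A → 0 ≤ B → A ≤ C → B ≤ D → toFun A B ≤ toFun C D
  transformer : ∀ A B C, 0 ≤ A → 0 ≤ B → 0 ≤ C →
    C * toFun A B * C ≤ toFun (C * A * C) (C * B * C)
  cont : ∀ (A B : ℕ → 𝓗 →L[ℂ] 𝓗) (A₀ B₀ : 𝓗 →L[ℂ] 𝓗),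
    (∀ n, 0 ≤ A n) → (∀ n, 0 ≤ B n) → DecreasesTo A A₀ → DecreasesTo B B₀ →
    DecreasesTo (fun n => toFun (A n) (B n)) (toFun A₀ B₀)
  map_one : toFun 1 1 = 1

/-- The operator mean of two operators `A`, `B` on a (finite-dimensional) Hilbert space `E`,
computed through an isometric embedding `V : E → 𝓗`, as `V* Λ(V A V*, V B V*) V`. -/
def OperatorMean.onSubspace (Λ : OperatorMean 𝓗) {E : Type*} [NormedAddCommGroup E]
    [InnerProductSpace ℂ E] [CompleteSpace E] (V : E →ₗᵢ[ℂ] 𝓗) (A B : E →L[ℂ] E) : E →L[ℂ] E :=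
  let W : E →L[ℂ] 𝓗 := V.toContinuousLinearMap
  W.adjoint ∘L Λ.toFun (W ∘L A ∘L W.adjoint) (W ∘L B ∘L W.adjoint) ∘L W

end OperatorMeans

/-! ### Tracial matrix algebras, amplifications

The algebra `M` is a unital `*`-subalgebra of the full matrix algebra over an index set `ι`,
with the restriction of the normalized trace as its tracial state. -/

section Algebras

variable {ι : Type*} [Fintype ι] [DecidableEq ι]

/-- The normalized trace. -/
def tau (x : Matrix ι ι ℂ) : ℂ := (Fintype.card ι : ℂ)⁻¹ * x.trace

/-- The `(k, l)` block of an element of `M_m(M_ι(ℂ))`. -/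
def block {m : ℕ} (X : Matrix (Fin m × ι) (Fin m × ι) ℂ) (k l : Fin m) : Matrix ι ι ℂ :=
  Matrix.of fun p q => X (k, p) (l, q)

/-- The matrix of `M_m(M_ι(ℂ))` with given blocks. -/
def ofBlocks {m : ℕ} (y : Fin m → Fin m → Matrix ι ι ℂ) : Matrix (Fin m × ι) (Fin m × ι) ℂ :=
  Matrix.of fun p q => y p.1 q.1 p.2 q.2

theorem block_mul {m : ℕ} (X Y : Matrix (Fin m × ι) (Fin m × ι) ℂ) (k l : Fin m) :
    block (X * Y) k l = ∑ j, block X k j * block Y j l := by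
  ext p q
  simp [block, Matrix.mul_apply, Matrix.sum_apply, Fintype.sum_prod_type]

theorem block_algebraMap {m : ℕ} (r : ℂ) (k l : Fin m) :
    block (algebraMap ℂ (Matrix (Fin m × ι) (Fin m × ι) ℂ) r) k l
      = if k = l then algebraMap ℂ (Matrix ι ι ℂ) r else 0 := by
  ext p q
  by_cases h : k = l
  · subst h
    simp [block, Matrix.algebraMap_matrix_apply]
  · simp [block, Matrix.algebraMap_matrix_apply, h]

/-- `M ⊗ M_m(ℂ)`, as the algebra of `m × m` block matrices with blocks in `M`. -/
def amplify (m : ℕ) (M : StarSubalgebra ℂ (Matrix ι ι ℂ)) :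
    StarSubalgebra ℂ (Matrix (Fin m × ι) (Fin m × ι) ℂ) where
  carrier := {X | ∀ k l, block X k l ∈ M}
  mul_mem' := by
    intro X Y hX hY k l
    rw [block_mul]
    exact sum_mem fun j _ => mul_mem (hX k j) (hY j l)
  add_mem' := by
    intro X Y hX hY k l
    exact add_mem (hX k l) (hY k l)
  algebraMap_mem' := by
    intro r k l
    rw [block_algebraMap]
    split_ifs
    · exact M.algebraMap_mem r
    · exact zero_mem M
  star_mem' := by
    intro X hX k l
    exact star_mem (hX l k)

/-- `T ⊗ id` on `M ⊗ M_m(ℂ)`: `T` is applied to every block. -/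
def amplifyMap (m : ℕ) {M : StarSubalgebra ℂ (Matrix ι ι ℂ)} (T : M →ₗ[ℂ] M) :
    amplify m M →ₗ[ℂ] amplify m M where
  toFun X := ⟨ofBlocks fun k l => (T ⟨block X.1 k l, X.2 k l⟩ : Matrix ι ι ℂ),
    fun k l => (T ⟨block X.1 k l, X.2 k l⟩).2⟩
  map_add' X Y := by
    ext p q
    exact congrFun (congrFun (congrArg Subtype.val
      (T.map_add ⟨block X.1 p.1 q.1, X.2 p.1 q.1⟩ ⟨block Y.1 p.1 q.1, Y.2 p.1 q.1⟩)) p.2) q.2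
  map_smul' c X := by
    ext p q
    exact congrFun (congrFun (congrArg Subtype.val
      (T.map_smul c ⟨block X.1 p.1 q.1, X.2 p.1 q.1⟩)) p.2) q.2

/-! ### Quantum Markov semigroups -/

/-- A linear map `T : M → M` is completely positive. -/
def IsCompletelyPositive {M : StarSubalgebra ℂ (Matrix ι ι ℂ)} (T : M →ₗ[ℂ] M) : Prop :=
  ∀ (m : ℕ) (X : amplify m M), 0 ≤ (X : Matrix (Fin m × ι) (Fin m × ι) ℂ) →
    0 ≤ (amplifyMap m T X : Matrix (Fin m × ι) (Fin m × ι) ℂ)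

/-- `(P t)_{t ≥ 0}` is a tracially symmetric quantum Markov semigroup on `M`
(the values for `t < 0` play no role). -/
structure IsSymmetricQMS {M : StarSubalgebra ℂ (Matrix ι ι ℂ)} (P : ℝ → M →ₗ[ℂ] M) : Prop where
  zero : P 0 = LinearMap.id
  add : ∀ s t, 0 ≤ s → 0 ≤ t → P (s + t) = P s ∘ₗ P t
  completelyPositive : ∀ t, 0 ≤ t → IsCompletelyPositive (P t)
  unital : ∀ t, 0 ≤ t → P t 1 = 1
  continuous : ∀ x, ContinuousOn (fun t => P t x) (Set.Ici 0)
  symmetric : ∀ t, 0 ≤ t → ∀ x y : M,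
    tau ((P t x : Matrix ι ι ℂ) * (y : Matrix ι ι ℂ))
      = tau ((x : Matrix ι ι ℂ) * (P t y : Matrix ι ι ℂ))

/-- The generator `L x = lim_{t ↘ 0} (x - P t x) / t`, so that `P t = exp (-t L)`. -/
def generator {M : StarSubalgebra ℂ (Matrix ι ι ℂ)} (P : ℝ → M →ₗ[ℂ] M) (x : M) : M :=
  limUnder (𝓝[>] (0 : ℝ)) fun t : ℝ => ((t : ℂ)⁻¹) • (x - P t x)

/-- The carré du champ operator. -/
def carre {M : StarSubalgebra ℂ (Matrix ι ι ℂ)} (P : ℝ → M →ₗ[ℂ] M) (a b : M) : M :=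
  (1 / 2 : ℂ) • (star a * generator P b + star (generator P a) * b - generator P (star a * b))

/-- The function `t ↦ (1 - exp (-2 K t)) / (K N)`, with its limit `2 t / N` when `K = 0`. -/
def dimCoeff (K N t : ℝ) : ℝ :=
  if K = 0 then 2 * t / N else (1 - Real.exp (-2 * K * t)) / (K * N)

/-- The complete Bakry–Émery condition `CBE(K, N)`. -/
def CBE {M : StarSubalgebra ℂ (Matrix ι ι ℂ)} (P : ℝ → M →ₗ[ℂ] M) (K N : ℝ) : Prop :=
  ∀ (n : ℕ) (x : Fin n → M) (t : ℝ), 0 < t →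
    ofBlocks (fun j k => (carre P (P t (x j)) (P t (x k)) : Matrix ι ι ℂ))
      ≤ (Real.exp (-2 * K * t) : ℂ) •
          ofBlocks (fun j k => (P t (carre P (x j) (x k)) : Matrix ι ι ℂ))
        - (dimCoeff K N t : ℂ) •
          ofBlocks (fun j k =>
            (star (generator P (P t (x j))) * generator P (P t (x k)) : Matrix ι ι ℂ))

/-! ### Lindblad forms and the gradient estimate -/

/-- The derivation `[v, ·]`. -/
def partialD (v x : Matrix ι ι ℂ) : Matrix ι ι ℂ := v * x - x * v

/-- The generator of `P` has the Lindblad form `L = ∑ j, ∂ⱼ† ∂ⱼ` on `M`, where `∂ⱼ = [vⱼ, ·]`,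
`∂ⱼ† = [vⱼ*, ·]`, and the families `(vⱼ)` and `(vⱼ*)` agree up to a permutation. The operators
`vⱼ` belong to the full matrix algebra that contains `M`, not necessarily to `M`. -/
def IsLindbladForm {M : StarSubalgebra ℂ (Matrix ι ι ℂ)} (P : ℝ → M →ₗ[ℂ] M) {d : ℕ}
    (v : Fin d → Matrix ι ι ℂ) : Prop :=
  (∃ σ : Equiv.Perm (Fin d), ∀ j, v (σ j) = star (v j)) ∧
  ∀ x : M, (generator P x : Matrix ι ι ℂ)
    = ∑ j, partialD (star (v j)) (partialD (v j) (x : Matrix ι ι ℂ))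

/-- Matrices as vectors of the Hilbert space with inner product `trace (x* y)`. -/
def vec : Matrix ι ι ℂ ≃ₗ[ℂ] EuclideanSpace ℂ (ι × ι) where
  toFun x := WithLp.toLp 2 fun p => x p.1 p.2
  invFun f := Matrix.of fun i j => f (i, j)
  map_add' _ _ := rfl
  map_smul' _ _ := rfl
  left_inv _ := rfl
  right_inv _ := rfl

/-- Left multiplication by `ρ`, as an operator on the Hilbert space of matrices. -/
def leftMul (ρ : Matrix ι ι ℂ) : EuclideanSpace ℂ (ι × ι) →L[ℂ] EuclideanSpace ℂ (ι × ι) :=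
  LinearMap.toContinuousLinearMap (vec.conj (LinearMap.mulLeft ℂ ρ))

/-- Right multiplication by `ρ`, as an operator on the Hilbert space of matrices. -/
def rightMul (ρ : Matrix ι ι ℂ) : EuclideanSpace ℂ (ι × ι) →L[ℂ] EuclideanSpace ℂ (ι × ι) :=
  LinearMap.toContinuousLinearMap (vec.conj (LinearMap.mulRight ℂ ρ))

variable {𝓗 : Type*} [NormedAddCommGroup 𝓗] [InnerProductSpace ℂ 𝓗] [CompleteSpace 𝓗]

/-- `‖∂ a‖²_ρ = ∑ j, ⟨∂ⱼ a, ρ̂ ∂ⱼ a⟩` with `ρ̂ = Λ(L(ρ), R(ρ))` and `⟨x, y⟩ = τ(x* y)`. -/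
def gradNormSq (Λ : OperatorMean 𝓗) (V : EuclideanSpace ℂ (ι × ι) →ₗᵢ[ℂ] 𝓗) {d : ℕ}
    (v : Fin d → Matrix ι ι ℂ) (ρ a : Matrix ι ι ℂ) : ℝ :=
  (Fintype.card ι : ℝ)⁻¹ * ∑ j, (inner ℂ (vec (partialD (v j) a))
    (Λ.onSubspace V (leftMul ρ) (rightMul ρ) (vec (partialD (v j) a)))).re

/-- The gradient estimate `GE(K, N)` for the operator mean `Λ`: `P` is a tracially symmetric
quantum Markov semigroup whose generator has a Lindblad form, and the estimate holds for each of
its Lindblad forms and each isometric embedding used to evaluate `Λ`. -/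
def GE (Λ : OperatorMean 𝓗) {M : StarSubalgebra ℂ (Matrix ι ι ℂ)} (P : ℝ → M →ₗ[ℂ] M)
    (K N : ℝ) : Prop :=
  IsSymmetricQMS P ∧
  (∃ (d : ℕ) (v : Fin d → Matrix ι ι ℂ), IsLindbladForm P v) ∧
  ∀ (d : ℕ) (v : Fin d → Matrix ι ι ℂ), IsLindbladForm P v →
  ∀ (V : EuclideanSpace ℂ (ι × ι) →ₗᵢ[ℂ] 𝓗) (t : ℝ), 0 ≤ t →
  ∀ a ρ : M, (ρ : Matrix ι ι ℂ).PosDef → tau (ρ : Matrix ι ι ℂ) = 1 →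
    gradNormSq Λ V v ρ (P t a)
      ≤ Real.exp (-2 * K * t) * gradNormSq Λ V v (P t ρ) a
        - dimCoeff K N t *
          ‖tau (star (a : Matrix ι ι ℂ) * (generator P (P t ρ) : Matrix ι ι ℂ))‖ ^ 2

/-- The complete gradient estimate `CGE(K, N)`: all `P t ⊗ id` on `M ⊗ M_m(ℂ)` satisfy
`GE(K, N)`. -/
def CGE (Λ : OperatorMean 𝓗) {M : StarSubalgebra ℂ (Matrix ι ι ℂ)} (P : ℝ → M →ₗ[ℂ] M)
    (K N : ℝ) : Prop :=
  ∀ m : ℕ, 1 ≤ m → GE Λ (fun t => amplifyMap m (P t)) K N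

/-! ### Schur multipliers -/

/-- The Schur multiplier `x ↦ [exp (-t a i j) x i j]` on a `*`-subalgebra that it preserves. -/
def schurOn (a : Matrix ι ι ℂ) (M : StarSubalgebra ℂ (Matrix ι ι ℂ))
    (hM : ∀ (t : ℝ), ∀ x ∈ M, (Matrix.of fun i j => Complex.exp (-t * a i j) * x i j) ∈ M)
    (t : ℝ) : M →ₗ[ℂ] M where
  toFun x := ⟨Matrix.of fun i j => Complex.exp (-t * a i j) * (x : Matrix ι ι ℂ) i j,
    hM t x.1 x.2⟩
  map_add' x y := by
    ext i j
    simp [mul_add]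
  map_smul' c x := by
    ext i j
    simp [mul_left_comm]

/-- The Schur multiplier semigroup `P t [x i j] = [exp (-t a i j) x i j]` on all matrices. -/
def schurSemigroup (a : Matrix ι ι ℂ) :
    ℝ → (⊤ : StarSubalgebra ℂ (Matrix ι ι ℂ)) →ₗ[ℂ] (⊤ : StarSubalgebra ℂ (Matrix ι ι ℂ)) :=
  schurOn a ⊤ fun _ _ _ => trivial

/-- A symmetric, nonnegative, conditionally negative definite symbol with zero diagonal. -/
structure IsCNDSymbol (a : Matrix ι ι ℂ) : Prop where
  diag : ∀ i, a i i = 0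
  symm : ∀ i j, a i j = a j i
  nonneg : ∀ i j, 0 ≤ a i j
  cnd : ∀ α : ι → ℂ, ∑ i, α i = 0 → ∑ i, ∑ j, star (α i) * α j * a i j ≤ 0

end Algebras

/-! ### Herz–Schur multipliers on finite groups -/

section Groups

variable {G : Type*} [Group G] [Fintype G] [DecidableEq G]

/-- The left regular representation, `lam g δ_h = δ_{g h}`. -/
def lam (g : G) : Matrix G G ℂ := Matrix.of fun x y => if x = g * y then 1 else 0

theorem lam_one : lam (1 : G) = 1 := by
  ext x y
  simp [lam, Matrix.one_apply]

theorem lam_mul (g h : G) : lam (g * h) = lam g * lam h := by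
  ext x y
  simp [lam, Matrix.mul_apply, mul_assoc]

theorem star_lam (g : G) : star (lam g) = lam g⁻¹ := by
  ext x y
  simp only [lam, Matrix.star_apply, Matrix.of_apply, eq_inv_mul_iff_mul_eq, eq_comm (a := y)]
  split_ifs <;> simp

variable (G) in
/-- The group algebra `ℂ[G]`, the linear span of the operators `lam g`. -/
def groupAlg : StarSubalgebra ℂ (Matrix G G ℂ) where
  carrier := Submodule.span ℂ (Set.range (lam (G := G)))
  mul_mem' := by
    intro x y hx hy
    have h := Submodule.mul_mem_mul hx hy
    rw [Submodule.span_mul_span] at h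
    refine Submodule.span_mono ?_ h
    rintro _ ⟨_, ⟨g, rfl⟩, _, ⟨k, rfl⟩, rfl⟩
    exact ⟨g * k, lam_mul g k⟩
  add_mem' := fun hx hy => Submodule.add_mem _ hx hy
  algebraMap_mem' := by
    intro r
    rw [Algebra.algebraMap_eq_smul_one, ← lam_one]
    exact Submodule.smul_mem _ _ (Submodule.subset_span ⟨1, rfl⟩)
  star_mem' := by
    intro x hx
    refine Submodule.span_induction ?_ ?_ ?_ ?_ hx
    · rintro _ ⟨g, rfl⟩
      rw [star_lam]
      exact Submodule.subset_span ⟨g⁻¹, rfl⟩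
    · rw [star_zero]
      exact Submodule.zero_mem _
    · intro x y _ _ hx hy
      rw [star_add]
      exact Submodule.add_mem _ hx hy
    · intro c x _ hx
      rw [star_smul]
      exact Submodule.smul_mem _ _ hx

theorem lam_mem (g : G) : lam g ∈ groupAlg G := Submodule.subset_span ⟨g, rfl⟩

theorem herzSchur_lam (ℓ : G → ℝ) (t : ℝ) (g : G) :
    (Matrix.of fun x y => Complex.exp (-t * (ℓ (x * y⁻¹) : ℂ)) * lam g x y)
      = Complex.exp (-t * ℓ g) • lam g := by
  ext x y
  by_cases h : x = g * y <;> simp [lam, h]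

theorem herzSchur_mem (ℓ : G → ℝ) (t : ℝ) (x : Matrix G G ℂ) (hx : x ∈ groupAlg G) :
    (Matrix.of fun g h => Complex.exp (-t * (Matrix.of fun g h : G => (ℓ (g * h⁻¹) : ℂ)) g h)
      * x g h) ∈ groupAlg G := by
  refine Submodule.span_induction (p := fun x _ => (Matrix.of fun g h =>
    Complex.exp (-t * (ℓ (g * h⁻¹) : ℂ)) * x g h) ∈ groupAlg G) ?_ ?_ ?_ ?_ hx
  · rintro _ ⟨g, rfl⟩
    rw [herzSchur_lam]
    exact (groupAlg G).smul_mem (lam_mem g) _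
  · convert zero_mem (groupAlg G) using 1
    ext
    simp
  · intro x y _ _ hx hy
    convert add_mem hx hy using 1
    ext
    simp [mul_add]
  · intro c x _ hx
    convert (groupAlg G).smul_mem hx c using 1
    ext
    simp [mul_left_comm]

/-- The semigroup on `ℂ[G]` with `P t (lam g) = exp (-t ℓ g) lam g`. The matrix entry `(g, h)` of
an element of `ℂ[G]` is its coefficient at `lam (g h⁻¹)`, so this is the restriction to `ℂ[G]` of
the Schur multiplier with symbol `ℓ (g h⁻¹)`. -/
def herzSchurSemigroup (ℓ : G → ℝ) : ℝ → groupAlg G →ₗ[ℂ] groupAlg G :=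
  schurOn (Matrix.of fun g h => (ℓ (g * h⁻¹) : ℂ)) (groupAlg G) (herzSchur_mem ℓ)

theorem herzSchurSemigroup_lam (ℓ : G → ℝ) (t : ℝ) (g : G) :
    herzSchurSemigroup ℓ t ⟨lam g, lam_mem g⟩
      = Complex.exp (-t * ℓ g) • (⟨lam g, lam_mem g⟩ : groupAlg G) :=
  Subtype.ext (herzSchur_lam ℓ t g)

/-- Conditionally negative definite length functions. -/
structure IsCNDLength (ℓ : G → ℝ) : Prop where
  nonneg : ∀ g, 0 ≤ ℓ g
  one : ℓ 1 = 0
  inv : ∀ g, ℓ g⁻¹ = ℓ g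
  cnd : ∀ α : G → ℂ, ∑ g, α g = 0 →
    ∑ g, ∑ h, star (α g) * α h * (ℓ (g⁻¹ * h) : ℂ) ≤ 0

/-- `(H, π, b)` is a 1-cocycle of `G` with `ℓ g = ‖b g‖²`; here `π` is an orthogonal
representation of `G` on the real Hilbert space `H`. -/
structure IsCocycleOf (ℓ : G → ℝ) {H : Type*} [NormedAddCommGroup H] [InnerProductSpace ℝ H]
    (π : G →* (H ≃ₗᵢ[ℝ] H)) (b : G → H) : Prop where
  cocycle : ∀ g h, b (g * h) = b g + π g (b h)
  length : ∀ g, ℓ g = ‖b g‖ ^ 2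

end Groups

/-- The word length `min {k, n - k}` on the cyclic group of order `n`. -/
def wordLength (n : ℕ) [NeZero n] (k : Multiplicative (ZMod n)) : ℝ :=
  (min (Multiplicative.toAdd k).val (n - (Multiplicative.toAdd k).val) : ℕ)

/-- The Hamming length `#{j | σ j ≠ j}` on the symmetric group. -/
def hammingLength (n : ℕ) (σ : Equiv.Perm (Fin n)) : ℝ :=
  (Finset.univ.filter fun j => σ j ≠ j).card

end QMarkov

end

open QMarkov

open QMarkov

namespace QMarkov

set_option linter.unusedSectionVars false

/-! ### Positive semidefinite kernels -/

section Kernels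

variable {κ : Type*} [Fintype κ]

/-! All four parts concern one object: the Schur multiplier with symbol `|b i - b j|²` for points `b
i` in `ℝ^r`, possibly restricted to a subalgebra. Schoenberg's theorem
(`IsCNDSymbol.exists_eq_sqDist`) produces such points, and `r` becomes the dimension bound.

Everything reduces to positivity of `dimKernel`. Once the factors `exp (-t|c p|²)` and `exp (-t|c
q|²)` are pulled out, it is, with `s = ⟨c p, c q⟩`, `s (exp (2ts) - 1 - 2ts) + 2t (s² - |c p|² |c
q|² / N)`. The first summand is a power series in a Gram kernel with nonnegative coefficients, hence
positive by the Schur product theorem. The second is positive for `r ≤ N` by the Cauchy–Schwarz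
bound `|tr Y|² ≤ r ‖Y‖²` for `r × r` matrices.

For CBE, the two sides differ by a sum over rows `l` of rank-one positive matrices, each multiplied
entrywise by the `dimKernel` of the points `b l - b i`.

For GE, the gradient norm depends only on the carré du champ (`gradNormSq_eq_of_isLindbladForm`), so
the diagonal coordinate matrices may serve as Lindblad operators. With `c (i, j) = b i - b j`,
passing from `ρ` to `P t ρ` multiplies the matrices of `L(ρ)` and `R(ρ)` entrywise by the Gaussian
kernel of `c`. Operator means are superadditive under such multiplication
(`OperatorMean.hadamard_compress_le`), so `Λ(L(ρ), R(ρ))` times that kernel bounds the mean at `P t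
ρ` from below. Positivity of `dimKernel` then leaves the term `(2t/N) ⟨z, ρ̂ z⟩` with `z = L P t a`,
and Cauchy–Schwarz against the identity, where `ρ̂ 1 = ρ`, turns it into the required square.

The axioms give the transformer inequality for positive operators only. Covariance under the
unitaries needed to move between embeddings follows because a rotation is a product of positive
invertible operators. -/

theorem posSemidef_of_tendsto {M : ℕ → Matrix κ κ ℂ} {F : Matrix κ κ ℂ}
    (hM : ∀ n, (M n).PosSemidef) (hF : ∀ p q, Tendsto (fun n => M n p q) atTop (𝓝 (F p q))) :
    F.PosSemidef := by
  have hF' : Tendsto M atTop (𝓝 F) := tendsto_pi_nhds.2 fun p => tendsto_pi_nhds.2 (hF p)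
  refine Matrix.PosSemidef.of_dotProduct_mulVec_nonneg ?_ fun x => ?_
  · ext p q
    have h1 := (continuous_star.tendsto _).comp (hF q p)
    exact tendsto_nhds_unique (f := fun n => M n p q)
      (h1.congr fun n => congrFun (congrFun (hM n).isHermitian p) q) (hF p q)
  · have : Continuous fun N : Matrix κ κ ℂ => star x ⬝ᵥ N.mulVec x := by fun_prop
    exact ge_of_tendsto' ((this.tendsto F).comp hF') fun n => (hM n).dotProduct_mulVec_nonneg x

theorem posSemidef_mul_entries {A B : Matrix κ κ ℂ} (hA : A.PosSemidef) (hB : B.PosSemidef) :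
    (Matrix.of fun p q => A p q * B p q).PosSemidef :=
  Matrix.PosSemidef.hadamard hA hB

theorem posSemidef_hadamard_pow {S : Matrix κ κ ℂ} (hS : S.PosSemidef) (n : ℕ) :
    (Matrix.of fun p q => S p q ^ n).PosSemidef := by
  induction n with
  | zero =>
    convert Matrix.posSemidef_vecMulVec_self_star (fun _ : κ => (1 : ℂ)) using 1
    ext p q
    simp [Matrix.vecMulVec]
  | succ n ih =>
    exact posSemidef_mul_entries ih hS

/-- Entrywise powers are positive by the Schur product theorem, and the cone is closed under limits.
The exponents `e n` leave room for series that start at a later power. -/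
theorem posSemidef_of_hasSum {S F : Matrix κ κ ℂ} (hS : S.PosSemidef) (a : ℕ → ℝ)
    (ha : ∀ n, 0 ≤ a n) (e : ℕ → ℕ)
    (hF : ∀ p q, HasSum (fun n => (a n : ℂ) * S p q ^ e n) (F p q)) : F.PosSemidef := by
  refine posSemidef_of_tendsto
    (M := fun N => ∑ n ∈ Finset.range N, (a n : ℂ) • Matrix.of fun p q => S p q ^ e n) ?_ ?_
  · intro N
    refine Matrix.posSemidef_sum _ fun n _ => (posSemidef_hadamard_pow hS _).smul ?_
    exact_mod_cast ha n
  · intro p q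
    convert (hF p q).tendsto_sum_nat using 2 with N
    simp [Matrix.sum_apply]

/-- The Gram kernel of a family of real vectors. -/
noncomputable def gramKernel {r : ℕ} (c : κ → Fin r → ℝ) : Matrix κ κ ℂ :=
  Matrix.of fun p q => ((c p ⬝ᵥ c q : ℝ) : ℂ)

theorem posSemidef_gramKernel {r : ℕ} (c : κ → Fin r → ℝ) : (gramKernel c).PosSemidef := by
  convert Matrix.posSemidef_conjTranspose_mul_self
    (Matrix.of fun (k : Fin r) p => (c p k : ℂ)) using 1
  ext p q
  simp [gramKernel, Matrix.mul_apply, dotProduct]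

theorem hasSum_real_exp (x : ℝ) : HasSum (fun n => x ^ n / n.factorial) (Real.exp x) := by
  rw [Real.exp_eq_exp_ℝ]
  exact NormedSpace.expSeries_div_hasSum_exp x

theorem posSemidef_exp_gram {r : ℕ} (c : κ → Fin r → ℝ) {t : ℝ} (ht : 0 ≤ t) :
    (Matrix.of fun p q => (Real.exp (t * (c p ⬝ᵥ c q)) : ℂ)).PosSemidef := by
  refine posSemidef_of_hasSum (posSemidef_gramKernel c) (fun n => t ^ n / n.factorial)
    (fun n => by positivity) id fun p q => ?_
  have h := Complex.hasSum_ofReal.2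
    (hasSum_real_exp (t * (c p ⬝ᵥ c q)))
  refine (congrArg (HasSum · _) (funext fun n => ?_)).mp h
  simp only [gramKernel, id]
  push_cast
  simp
  ring

/-- The tail of the exponential series from degree two on still has nonnegative coefficients. -/
theorem posSemidef_exp_gram_sub {r : ℕ} (c : κ → Fin r → ℝ) {t : ℝ} (ht : 0 ≤ t) :
    (Matrix.of fun p q => ((Real.exp (t * (c p ⬝ᵥ c q)) - 1 - t * (c p ⬝ᵥ c q) : ℝ) : ℂ)).PosSemidef := by
  refine posSemidef_of_hasSum (posSemidef_gramKernel c) (fun n => t ^ (n + 2) / (n + 2).factorial)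
    (fun n => by positivity) (· + 2) fun p q => ?_
  have h := Complex.hasSum_ofReal.2
    ((hasSum_nat_add_iff' 2).2 (hasSum_real_exp (t * (c p ⬝ᵥ c q))))
  rw [show ((Matrix.of fun p q => ((Real.exp (t * (c p ⬝ᵥ c q)) - 1 - t * (c p ⬝ᵥ c q) : ℝ) : ℂ))
    p q) = ((Real.exp (t * (c p ⬝ᵥ c q)) - ∑ i ∈ Finset.range 2,
      (t * (c p ⬝ᵥ c q)) ^ i / i.factorial : ℝ) : ℂ) by
    simp [Finset.sum_range_succ]; ring]
  refine (congrArg (HasSum · _) (funext fun n => ?_)).mp h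
  simp only [gramKernel]
  push_cast
  simp
  ring

/-- The only place where the dimension enters. The quadratic form at `x` is `‖Y‖² - |tr Y|² / N`
(Hilbert–Schmidt norm) for the `r × r` matrix `Y = ∑ x p • c p (c p)ᵀ`, and the trace sees only the
`r` diagonal entries. -/
theorem posSemidef_gram_sq_sub {r : ℕ} (c : κ → Fin r → ℝ) {N : ℝ} (hN : 0 < N) (hr : (r : ℝ) ≤ N) :
    (Matrix.of fun p q => (((c p ⬝ᵥ c q) ^ 2 - N⁻¹ * (c p ⬝ᵥ c p) * (c q ⬝ᵥ c q) : ℝ) : ℂ)).PosSemidef := by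
  refine Matrix.PosSemidef.of_dotProduct_mulVec_nonneg ?_ fun x => ?_
  · ext p q
    simp [dotProduct_comm (c q) (c p)]
    ring
  set y : Fin r → Fin r → ℂ := fun k l => ∑ p, x p * c p k * c p l with hy
  have hsum : star x ⬝ᵥ (Matrix.of fun p q =>
      (((c p ⬝ᵥ c q) ^ 2 - N⁻¹ * (c p ⬝ᵥ c p) * (c q ⬝ᵥ c q) : ℝ) : ℂ)).mulVec x
      = ((∑ k, ∑ l, ‖y k l‖ ^ 2 - N⁻¹ * ‖∑ k, y k k‖ ^ 2 : ℝ) : ℂ) := by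
    have h1 : ∀ k l, ((‖y k l‖ ^ 2 : ℝ) : ℂ)
        = ∑ p, ∑ q, star (x p) * x q * (c p k * c p l * (c q k * c q l)) := by
      intro k l
      rw [Complex.ofReal_pow, ← Complex.conj_mul', hy, map_sum, Finset.sum_mul_sum]
      refine Finset.sum_congr rfl fun p _ => Finset.sum_congr rfl fun q _ => ?_
      simp
      ring
    have h2 : ((‖∑ k, y k k‖ ^ 2 : ℝ) : ℂ)
        = ∑ p, ∑ q, star (x p) * x q * ((c p ⬝ᵥ c p : ℝ) * (c q ⬝ᵥ c q : ℝ)) := by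
      have : ∑ k, y k k = ∑ p, x p * ((c p ⬝ᵥ c p : ℝ) : ℂ) := by
        rw [hy, Finset.sum_comm]
        refine Finset.sum_congr rfl fun p _ => ?_
        simp [dotProduct, Finset.mul_sum, mul_assoc]
      rw [this]
      push_cast
      rw [← Complex.conj_mul', map_sum, Finset.sum_mul_sum]
      refine Finset.sum_congr rfl fun p _ => Finset.sum_congr rfl fun q _ => ?_
      simp
      ring
    have h3 : ∑ k, ∑ l, ((‖y k l‖ ^ 2 : ℝ) : ℂ)
        = ∑ p, ∑ q, star (x p) * x q * (((c p ⬝ᵥ c q) ^ 2 : ℝ) : ℂ) := by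
      simp_rw [h1]
      rw [Finset.sum_congr rfl fun k _ => Finset.sum_comm]
      rw [Finset.sum_comm]
      refine Finset.sum_congr rfl fun p _ => ?_
      rw [Finset.sum_congr rfl fun k _ => Finset.sum_comm]
      rw [Finset.sum_comm]
      refine Finset.sum_congr rfl fun q _ => ?_
      simp only [dotProduct, sq, Finset.sum_mul_sum]
      push_cast
      rw [Finset.mul_sum]
      refine Finset.sum_congr rfl fun k _ => ?_
      rw [Finset.mul_sum]
      refine Finset.sum_congr rfl fun l _ => ?_
      ring
    rw [Complex.ofReal_sub, Complex.ofReal_mul, h2, Complex.ofReal_sum]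
    simp_rw [Complex.ofReal_sum]
    rw [h3, Finset.mul_sum, ← Finset.sum_sub_distrib]
    simp only [dotProduct, Matrix.mulVec, Pi.star_apply]
    refine Finset.sum_congr rfl fun p _ => ?_
    rw [Finset.mul_sum, Finset.mul_sum, ← Finset.sum_sub_distrib]
    refine Finset.sum_congr rfl fun q _ => ?_
    simp
    ring
  rw [hsum]
  have hb : ‖∑ k, y k k‖ ^ 2 ≤ r * ∑ k, ‖y k k‖ ^ 2 := by
    calc ‖∑ k, y k k‖ ^ 2 ≤ (∑ k, ‖y k k‖) ^ 2 := by gcongr; exact norm_sum_le _ _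
      _ ≤ _ := by simpa using sq_sum_le_card_mul_sum_sq (s := Finset.univ) (f := fun k => ‖y k k‖)
  have hd : ∑ k, ‖y k k‖ ^ 2 ≤ ∑ k, ∑ l, ‖y k l‖ ^ 2 :=
    Finset.sum_le_sum fun k _ =>
      Finset.single_le_sum (f := fun l => ‖y k l‖ ^ 2) (fun _ _ => sq_nonneg _) (Finset.mem_univ k)
  have h0 : 0 ≤ ∑ k, ‖y k k‖ ^ 2 := Finset.sum_nonneg fun _ _ => sq_nonneg _
  have : N⁻¹ * ‖∑ k, y k k‖ ^ 2 ≤ ∑ k, ∑ l, ‖y k l‖ ^ 2 := by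
    rw [inv_mul_le_iff₀ hN]
    calc _ ≤ _ := hb
      _ ≤ N * ∑ k, ‖y k k‖ ^ 2 := by gcongr
      _ ≤ _ := by gcongr
  exact_mod_cast sub_nonneg.2 this

/-- The Gaussian kernel. -/
noncomputable def gaussKernel {r : ℕ} (c : κ → Fin r → ℝ) (t : ℝ) : Matrix κ κ ℂ :=
  Matrix.of fun p q => (Real.exp (-t * ((c p - c q) ⬝ᵥ (c p - c q))) : ℂ)

theorem exp_neg_sqDist {r : ℕ} (u v : Fin r → ℝ) (t : ℝ) :
    Real.exp (-t * ((u - v) ⬝ᵥ (u - v)))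
      = Real.exp (-t * (u ⬝ᵥ u)) * Real.exp (-t * (v ⬝ᵥ v)) * Real.exp (2 * t * (u ⬝ᵥ v)) := by
  rw [← Real.exp_add, ← Real.exp_add]
  congr 1
  simp [sub_dotProduct, dotProduct_sub, dotProduct_comm v u]
  ring

theorem posSemidef_scale (f : κ → ℝ) {S : Matrix κ κ ℂ} (hS : S.PosSemidef) :
    (Matrix.of fun p q => (f p : ℂ) * f q * S p q).PosSemidef := by
  convert posSemidef_mul_entries
    (Matrix.posSemidef_vecMulVec_self_star (fun p => (f p : ℂ))) hS using 1
  ext p q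
  simp [Matrix.vecMulVec]

theorem posSemidef_gaussKernel {r : ℕ} (c : κ → Fin r → ℝ) {t : ℝ} (ht : 0 ≤ t) :
    (gaussKernel c t).PosSemidef := by
  convert posSemidef_scale (fun p => Real.exp (-t * (c p ⬝ᵥ c p)))
    (posSemidef_exp_gram c (by positivity : 0 ≤ 2 * t)) using 1
  ext p q
  simp only [gaussKernel, exp_neg_sqDist, Matrix.of_apply]
  push_cast
  ring

/-- The difference of the two sides of the dimensional estimates, as a kernel. -/
noncomputable def dimKernel {r : ℕ} (c : κ → Fin r → ℝ) (t N : ℝ) : Matrix κ κ ℂ :=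
  Matrix.of fun p q => ((Real.exp (-t * ((c p - c q) ⬝ᵥ (c p - c q))) * (c p ⬝ᵥ c q)
    - Real.exp (-t * (c p ⬝ᵥ c p)) * Real.exp (-t * (c q ⬝ᵥ c q)) * (c p ⬝ᵥ c q)
    - 2 * t / N * (Real.exp (-t * (c p ⬝ᵥ c p)) * (c p ⬝ᵥ c p))
      * (Real.exp (-t * (c q ⬝ᵥ c q)) * (c q ⬝ᵥ c q)) : ℝ) : ℂ)

/-- Writing `exp (-t|c p - c q|²)` as `exp (-t|c p|²) exp (-t|c q|²) exp (2t⟨c p, c q⟩)` makes the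
outer two exponentials a common rank-one factor. Adding and subtracting `2t⟨c p, c q⟩²` splits what
is left into the two preceding positive kernels. -/
theorem posSemidef_dimKernel {r : ℕ} (c : κ → Fin r → ℝ) {t N : ℝ} (ht : 0 ≤ t) (hN : 0 < N)
    (hr : (r : ℝ) ≤ N) : (dimKernel c t N).PosSemidef := by
  have h1 := posSemidef_mul_entries (posSemidef_gramKernel c)
    (posSemidef_exp_gram_sub c (by positivity : 0 ≤ 2 * t))
  have h2 := (posSemidef_gram_sq_sub c hN hr).smul (show (0 : ℂ) ≤ ((2 * t : ℝ) : ℂ) by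
    exact_mod_cast (by positivity : 0 ≤ 2 * t))
  convert posSemidef_scale (fun p => Real.exp (-t * (c p ⬝ᵥ c p))) (h1.add h2) using 1
  ext p q
  simp only [dimKernel, gramKernel, Matrix.of_apply, Matrix.add_apply,
    Matrix.smul_apply, smul_eq_mul, exp_neg_sqDist]
  norm_cast
  ring

end Kernels

/-! ### Schur multiplier semigroups -/

section Schur

variable {ι : Type*} [Fintype ι] [DecidableEq ι] {a : Matrix ι ι ℂ}
  {M : StarSubalgebra ℂ (Matrix ι ι ℂ)}
  {hM : ∀ (t : ℝ), ∀ x ∈ M, (Matrix.of fun i j => Complex.exp (-t * a i j) * x i j) ∈ M}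

theorem matrix_nonneg_iff {κ : Type*} [Fintype κ] {A : Matrix κ κ ℂ} : 0 ≤ A ↔ A.PosSemidef :=
  Matrix.nonneg_iff_posSemidef

theorem matrix_le_of_sub_eq {κ : Type*} [Fintype κ] {A B C : Matrix κ κ ℂ} (hC : C.PosSemidef)
    (h : B - A = C) : A ≤ B :=
  sub_nonneg.1 (h ▸ matrix_nonneg_iff.2 hC)

theorem isClosed_starSubalgebra (M : StarSubalgebra ℂ (Matrix ι ι ℂ)) :
    IsClosed (M : Set (Matrix ι ι ℂ)) :=
  (Subalgebra.toSubmodule M.toSubalgebra).closed_of_finiteDimensional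

theorem tendsto_expQuotient (z w : ℂ) :
    Tendsto (fun t : ℝ => (t : ℂ)⁻¹ * (w - Complex.exp (-t * z) * w)) (𝓝[>] (0 : ℝ)) (𝓝 (z * w)) := by
  have h1 : HasDerivAt (fun t : ℝ => w - Complex.exp (-t * z) * w) (z * w) 0 := by
    have h0 : HasDerivAt (fun t : ℝ => -(t : ℂ) * z) (-1 * z) 0 :=
      (Complex.ofRealCLM.hasDerivAt.neg).mul_const z
    have h := (h0.cexp.mul_const w).const_sub w
    rwa [show -(Complex.exp (-((0 : ℝ) : ℂ) * z) * (-1 * z) * w) = z * w by simp] at h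
  refine h1.tendsto_slope_zero_right.congr fun t => ?_
  simp

theorem tendsto_schurQuotient (x : M) :
    Tendsto (fun t : ℝ => ((((t : ℂ)⁻¹) • (x - schurOn a M hM t x) : M) : Matrix ι ι ℂ))
      (𝓝[>] (0 : ℝ)) (𝓝 (Matrix.of fun i j => a i j * (x : Matrix ι ι ℂ) i j)) :=
  tendsto_pi_nhds.2 fun i => tendsto_pi_nhds.2 fun j =>
    tendsto_expQuotient (a i j) ((x : Matrix ι ι ℂ) i j)

/-- A finite-dimensional subalgebra is closed, so it contains the limit of the difference quotients.
-/
theorem symbol_mul_mem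
    (hM : ∀ (t : ℝ), ∀ x ∈ M, (Matrix.of fun i j => Complex.exp (-t * a i j) * x i j) ∈ M) (x : M) :
    (Matrix.of fun i j => a i j * (x : Matrix ι ι ℂ) i j) ∈ M :=
  (isClosed_starSubalgebra M).mem_of_tendsto (tendsto_schurQuotient (hM := hM) x)
    (Eventually.of_forall fun _ => Subtype.coe_prop _)

theorem generator_schurOn (x : M) :
    (generator (schurOn a M hM) x : Matrix ι ι ℂ)
      = Matrix.of fun i j => a i j * (x : Matrix ι ι ℂ) i j := by
  have h : Tendsto (fun t : ℝ => ((t : ℂ)⁻¹) • (x - schurOn a M hM t x)) (𝓝[>] (0 : ℝ))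
      (𝓝 ⟨_, symbol_mul_mem hM x⟩) := tendsto_subtype_rng.2 (tendsto_schurQuotient x)
  rw [generator, h.limUnder_eq]

/-- The symbol given by the squared distances of the points `b i`. -/
noncomputable def sqDist {r : ℕ} (b : ι → Fin r → ℝ) : Matrix ι ι ℂ :=
  Matrix.of fun i j => (((b i - b j) ⬝ᵥ (b i - b j) : ℝ) : ℂ)

variable {r : ℕ} {b : ι → Fin r → ℝ}
  {hMb : ∀ (t : ℝ), ∀ x ∈ M, (Matrix.of fun i j => Complex.exp (-t * sqDist b i j) * x i j) ∈ M}

theorem amplify_sqDist_mem (m : ℕ)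
    (hMb : ∀ (t : ℝ), ∀ x ∈ M, (Matrix.of fun i j => Complex.exp (-t * sqDist b i j) * x i j) ∈ M)
    (t : ℝ) (X : Matrix (Fin m × ι) (Fin m × ι) ℂ) (hX : X ∈ amplify m M) :
    (Matrix.of fun p q => Complex.exp (-t * sqDist (fun p : Fin m × ι => b p.2) p q) * X p q)
      ∈ amplify m M :=
  fun k l => hMb t (block X k l) (hX k l)

/-- An amplified Schur multiplier is again one, with every point repeated `m` times in the same
`ℝ^r`. Hence GE for all Schur multipliers already contains CGE. -/
theorem amplifyMap_schurOn (m : ℕ) (t : ℝ) :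
    amplifyMap m (schurOn (sqDist b) M hMb t)
      = schurOn (sqDist fun p : Fin m × ι => b p.2) (amplify m M) (amplify_sqDist_mem m hMb) t :=
  LinearMap.ext fun _ => Subtype.ext rfl

theorem exp_sqDist (b : ι → Fin r → ℝ) (t : ℝ) (i j : ι) :
    Complex.exp (-t * sqDist b i j) = gaussKernel b t i j := by
  simp [sqDist, gaussKernel]

theorem schurOn_sqDist_apply (t : ℝ) (x : M) (i j : ι) :
    (schurOn (sqDist b) M hMb t x : Matrix ι ι ℂ) i j
      = gaussKernel b t i j * (x : Matrix ι ι ℂ) i j := by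
  rw [← exp_sqDist]
  rfl

theorem gaussKernel_comm (b : ι → Fin r → ℝ) (t : ℝ) (i j : ι) :
    gaussKernel b t i j = gaussKernel b t j i := by
  simp only [gaussKernel, Matrix.of_apply]
  rw [← neg_sub, neg_dotProduct_neg]

theorem star_gaussKernel (b : ι → Fin r → ℝ) (t : ℝ) (i j : ι) :
    star (gaussKernel b t i j) = gaussKernel b t i j := by
  simp only [gaussKernel, Matrix.of_apply]
  exact Complex.conj_ofReal _

theorem isSymmetricQMS_schurOn : IsSymmetricQMS (schurOn (sqDist b) M hMb) where
  zero := by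
    ext x i j
    simp [schurOn]
  add s t _ _ := by
    ext x i j
    simp only [schurOn, LinearMap.coe_mk, AddHom.coe_mk, LinearMap.comp_apply, Matrix.of_apply]
    rw [← mul_assoc, ← Complex.exp_add]
    congr 2
    push_cast
    ring
  completelyPositive t ht m X hX := by
    rw [matrix_nonneg_iff] at hX ⊢
    convert posSemidef_mul_entries
      (posSemidef_gaussKernel (fun p : Fin m × ι => b p.2) ht) hX using 1
    ext p q
    exact schurOn_sqDist_apply (M := M) (hMb := hMb) t ⟨_, X.2 p.1 q.1⟩ p.2 q.2
  unital t _ := by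
    ext i j
    rw [schurOn_sqDist_apply]
    by_cases h : i = j
    · subst h
      simp [gaussKernel]
    · simp [h]
  continuous x := by
    refine Continuous.continuousOn (continuous_induced_rng.2 ?_)
    refine continuous_pi fun i => continuous_pi fun j => ?_
    show Continuous fun t : ℝ => Complex.exp (-t * sqDist b i j) * (x : Matrix ι ι ℂ) i j
    fun_prop
  symmetric t _ x y := by
    simp only [tau, Matrix.trace, Matrix.diag, Matrix.mul_apply, schurOn_sqDist_apply]
    congr 1
    refine Finset.sum_congr rfl fun i _ => Finset.sum_congr rfl fun j _ => ?_
    rw [gaussKernel_comm b t j i]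
    ring

/-- Polarization: the symbol enters as `(|b l - b k|² + |b l - b i|² - |b i - b k|²) / 2`. -/
theorem carre_schurOn (x y : M) (i k : ι) :
    (carre (schurOn (sqDist b) M hMb) x y : Matrix ι ι ℂ) i k
      = ∑ l, star ((x : Matrix ι ι ℂ) l i) * (y : Matrix ι ι ℂ) l k
          * (((b l - b i) ⬝ᵥ (b l - b k) : ℝ) : ℂ) := by
  show ((1 / 2 : ℂ) • (star (x : Matrix ι ι ℂ) * (generator (schurOn (sqDist b) M hMb) y : M)
    + star ((generator (schurOn (sqDist b) M hMb) x : M) : Matrix ι ι ℂ) * y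
    - (generator (schurOn (sqDist b) M hMb) (star x * y) : M))) i k = _
  simp only [generator_schurOn, StarMemClass.coe_star, MulMemClass.coe_mul, Matrix.smul_apply,
    Matrix.sub_apply, Matrix.add_apply, Matrix.mul_apply, Matrix.star_apply, Matrix.of_apply]
  rw [Finset.mul_sum, ← Finset.sum_add_distrib, ← Finset.sum_sub_distrib, smul_eq_mul,
    Finset.mul_sum]
  refine Finset.sum_congr rfl fun l _ => ?_
  have h : ((b l - b i) ⬝ᵥ (b l - b k) : ℝ) = 1 / 2 * ((b l - b k) ⬝ᵥ (b l - b k)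
      + (b l - b i) ⬝ᵥ (b l - b i) - (b i - b k) ⬝ᵥ (b i - b k)) := by
    simp only [sub_dotProduct, dotProduct_sub, dotProduct_comm (b k) (b l),
      dotProduct_comm (b k) (b i), dotProduct_comm (b i) (b l)]
    ring
  rw [h]
  simp only [sqDist, Matrix.of_apply, star_mul', Complex.star_def, Complex.conj_ofReal]
  push_cast
  ring

theorem CBE_schurOn {N : ℝ} (hN : 0 < N) (hr : (r : ℝ) ≤ N) :
    CBE (schurOn (sqDist b) M hMb) 0 N := by
  intro n x t ht
  -- The summation index of the matrix products in `Γ` and in `(L x)* (L y)` is the row `l`. For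
  -- fixed `l` both sides carry the same rank-one matrix, multiplied by kernels of the points `b l -
  -- b i`.
  have key : (∑ l : ι, Matrix.of fun p q : Fin n × ι =>
      (Matrix.vecMulVec (star fun p : Fin n × ι => (x p.1 : Matrix ι ι ℂ) l p.2)
        (fun p : Fin n × ι => (x p.1 : Matrix ι ι ℂ) l p.2)) p q
      * dimKernel (fun p : Fin n × ι => b l - b p.2) t N p q).PosSemidef :=
    Matrix.posSemidef_sum _ fun l _ => posSemidef_mul_entries
      (Matrix.posSemidef_vecMulVec_star_self _) (posSemidef_dimKernel _ ht.le hN hr)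
  refine matrix_le_of_sub_eq key ?_
  ext ⟨j, i⟩ ⟨k, i'⟩
  simp only [Matrix.sub_apply, Matrix.smul_apply, ofBlocks, Matrix.of_apply, carre_schurOn,
    schurOn_sqDist_apply, StarMemClass.coe_star, Matrix.mul_apply,
    Matrix.star_apply, generator_schurOn, dimCoeff, if_true, Matrix.sum_apply, Matrix.vecMulVec,
    Pi.star_apply, star_mul', star_gaussKernel, smul_eq_mul, Finset.mul_sum]
  rw [← Finset.sum_sub_distrib, ← Finset.sum_sub_distrib]
  refine Finset.sum_congr rfl fun l _ => ?_
  -- The Gaussian kernel of the shifted points does not depend on `l`; this is why `P t` can act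
  -- outside `Γ`.
  have e : (b l - b i - (b l - b i')) ⬝ᵥ (b l - b i - (b l - b i'))
      = (b i - b i') ⬝ᵥ (b i - b i') := by
    rw [show b l - b i - (b l - b i') = -(b i - b i') by abel, neg_dotProduct_neg]
  simp only [dimKernel, gaussKernel, sqDist, Matrix.of_apply, e, Complex.star_def,
    Complex.conj_ofReal]
  push_cast
  simp
  ring

end Schur

/-! ### Operator means: consequences of the axioms -/

section MatrixUnits

variable {R : Type*} [Ring R] [Algebra ℂ R] [StarRing R] [StarModule ℂ R] {e : Fin 2 → Fin 2 → R}

/-- A `2 × 2` matrix, acting through matrix units `e` and as the identity off their support. -/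
def unitBlock (e : Fin 2 → Fin 2 → R) (m : Matrix (Fin 2) (Fin 2) ℂ) : R :=
  1 + ∑ i, ∑ j, (m - 1) i j • e i j

theorem unitBlock_one : unitBlock e 1 = 1 := by
  simp [unitBlock]

theorem unitBlock_mul (he : ∀ i j k l, e i j * e k l = if j = k then e i l else 0)
    (m n : Matrix (Fin 2) (Fin 2) ℂ) :
    unitBlock e m * unitBlock e n = unitBlock e (m * n) := by
  have h : (∑ i, ∑ j, (m - 1) i j • e i j) * (∑ i, ∑ j, (n - 1) i j • e i j)
      = ∑ i, ∑ j, ((m - 1) * (n - 1)) i j • e i j := by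
    generalize m - 1 = m'
    generalize n - 1 = n'
    simp [Fin.sum_univ_two, mul_add, add_mul, he, Matrix.mul_apply, smul_smul, add_smul]
    module
  have h' : m * n - 1 = (m - 1) + (n - 1) + (m - 1) * (n - 1) := by noncomm_ring
  simp only [unitBlock, add_mul, mul_add, h, one_mul, mul_one]
  rw [h']
  simp only [Matrix.add_apply, add_smul, Finset.sum_add_distrib]
  abel

theorem star_unitBlock (hs : ∀ i j, star (e i j) = e j i) (m : Matrix (Fin 2) (Fin 2) ℂ) :
    star (unitBlock e m) = unitBlock e (star m) := by
  simp only [unitBlock, star_add, star_one, star_sum, star_smul, hs]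
  rw [Finset.sum_comm]
  congr 1
  refine Finset.sum_congr rfl fun i _ => Finset.sum_congr rfl fun j _ => ?_
  simp [Matrix.one_apply, eq_comm]

end MatrixUnits

section OperatorMeans

variable {𝓗 : Type*} [NormedAddCommGroup 𝓗] [InnerProductSpace ℂ 𝓗] [CompleteSpace 𝓗]
  (Λ : OperatorMean 𝓗)

/-- `T Λ(A, B) T* = Λ(T A T*, T B T*)` for all positive `A`, `B`. -/
def OperatorMean.Covariant (T : 𝓗 →L[ℂ] 𝓗) : Prop :=
  ∀ A B, 0 ≤ A → 0 ≤ B → Λ.toFun (T * A * star T) (T * B * star T) = T * Λ.toFun A B * star T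

variable {Λ}

theorem OperatorMean.Covariant.mul {S T : 𝓗 →L[ℂ] 𝓗} (hS : Λ.Covariant S) (hT : Λ.Covariant T) :
    Λ.Covariant (S * T) := by
  intro A B hA hB
  have := hS _ _ (star_right_conjugate_nonneg hA T) (star_right_conjugate_nonneg hB T)
  rw [hT A B hA hB] at this
  simpa only [star_mul, mul_assoc] using this

/-- The transformer inequality for `C` gives one direction; the one for its inverse `D`, conjugated
back by `C`, gives the other. -/
theorem OperatorMean.covariant_of_inverse {C D : 𝓗 →L[ℂ] 𝓗} (hC : 0 ≤ C) (hD : 0 ≤ D)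
    (hCD : C * D = 1) (hDC : D * C = 1) : Λ.Covariant C := by
  intro A B hA hB
  have hs : star C = C := hC.isSelfAdjoint
  rw [hs]
  have cancel : ∀ X : 𝓗 →L[ℂ] 𝓗, D * (C * X * C) * D = X := fun X => by
    rw [show D * (C * X * C) * D = (D * C) * X * (C * D) by noncomm_ring, hDC, hCD, one_mul, mul_one]
  have cancel' : ∀ X : 𝓗 →L[ℂ] 𝓗, C * (D * X * D) * C = X := fun X => by
    rw [show C * (D * X * D) * C = (C * D) * X * (D * C) by noncomm_ring, hDC, hCD, one_mul, mul_one]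
  refine le_antisymm ?_ (Λ.transformer A B C hA hB hC)
  have h := Λ.transformer (C * A * C) (C * B * C) D (conjugate_nonneg_of_nonneg hA hC)
    (conjugate_nonneg_of_nonneg hB hC) hD
  rw [cancel, cancel] at h
  have h' := conjugate_le_conjugate_of_nonneg h hC
  rwa [cancel'] at h'

theorem OperatorMean.covariant_star_mul_self {N N' : 𝓗 →L[ℂ] 𝓗} (h : N * N' = 1)
    (h' : N' * N = 1) : Λ.Covariant (star N * N) := by
  have hs : star N' * star N = 1 := by rw [← star_mul, h, star_one]
  have hs' : star N * star N' = 1 := by rw [← star_mul, h', star_one]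
  refine covariant_of_inverse (star_mul_self_nonneg N) (mul_star_self_nonneg N') ?_ ?_
  · rw [show star N * N * (N' * star N') = star N * (N * N') * star N' by noncomm_ring, h, mul_one, hs']
  · rw [show N' * star N' * (star N * N) = N' * (star N' * star N) * N by noncomm_ring, hs, mul_one, h']

theorem smul_one_nonneg {r : ℝ} (hr : 0 ≤ r) : 0 ≤ (r : ℂ) • (1 : 𝓗 →L[ℂ] 𝓗) := by
  rw [ContinuousLinearMap.nonneg_iff_isPositive]
  exact ContinuousLinearMap.isPositive_one.smul_of_nonneg (by exact_mod_cast hr)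

theorem OperatorMean.covariant_smul_one {s : ℝ} (hs : 0 < s) :
    Λ.Covariant ((s : ℂ) • (1 : 𝓗 →L[ℂ] 𝓗)) := by
  refine covariant_of_inverse (D := ((s⁻¹ : ℝ) : ℂ) • 1) (smul_one_nonneg hs.le)
    (smul_one_nonneg (inv_pos.2 hs).le) ?_ ?_ <;>
    rw [smul_mul_smul_comm, ← Complex.ofReal_mul]
  · rw [mul_inv_cancel₀ hs.ne', Complex.ofReal_one, one_smul, one_mul]
  · rw [inv_mul_cancel₀ hs.ne', Complex.ofReal_one, one_smul, one_mul]

/-- The rotation by a right angle, through matrix units, is a product of positive operators. -/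
theorem OperatorMean.covariant_unitBlock_rotation {e : Fin 2 → Fin 2 → 𝓗 →L[ℂ] 𝓗}
    (he : ∀ i j k l, e i j * e k l = if j = k then e i l else 0)
    (hs : ∀ i j, star (e i j) = e j i) : Λ.Covariant (unitBlock e !![0, -1; 1, 0]) := by
  have key : ∀ n n' : Matrix (Fin 2) (Fin 2) ℂ, n * n' = 1 → n' * n = 1 →
      Λ.Covariant (unitBlock e (star n * n)) := fun n n' h h' => by
    rw [← unitBlock_mul he, ← star_unitBlock hs]
    exact covariant_star_mul_self (N' := unitBlock e n')
      (by rw [unitBlock_mul he, h, unitBlock_one]) (by rw [unitBlock_mul he, h', unitBlock_one])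
  -- The rotation is `[1, -3; -3, 10] · [5, 2; 2, 1] · [4, 0; 0, 1] · [1/4, -1; -1, 5]`. Each factor
  -- is positive definite, written as `n* n` with an explicit inverse of `n`.
  have h1 := key !![1, -3; 0, 1] !![1, 3; 0, 1]
    (by simp [Matrix.one_fin_two]) (by simp [Matrix.one_fin_two])
  have h2 := key !![1, 0; 2, 1] !![1, 0; -2, 1]
    (by simp [Matrix.one_fin_two]) (by simp [Matrix.one_fin_two])
  have h3 := key !![2, 0; 0, 1] !![1 / 2, 0; 0, 1]
    (by simp [Matrix.one_fin_two]) (by simp [Matrix.one_fin_two])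
  have h4 := key !![1 / 2, -2; 0, 1] !![2, 4; 0, 1]
    (by simp [Matrix.one_fin_two]; norm_num) (by simp [Matrix.one_fin_two]; norm_num)
  have h := ((h1.mul h2).mul h3).mul h4
  rw [unitBlock_mul he, unitBlock_mul he, unitBlock_mul he] at h
  convert h using 2
  ext i j
  fin_cases i <;> fin_cases j <;>
    simp [Matrix.mul_apply, Fin.sum_univ_two, Matrix.star_apply, map_ofNat] <;> norm_num

theorem OperatorMean.map_smul_one {s : ℝ} (hs : 0 < s) {A B : 𝓗 →L[ℂ] 𝓗} (hA : 0 ≤ A)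
    (hB : 0 ≤ B) : Λ.toFun ((s : ℂ) • A) ((s : ℂ) • B) = (s : ℂ) • Λ.toFun A B := by
  have h := Λ.covariant_smul_one (Real.sqrt_pos.2 hs) A B hA hB
  have hT : ∀ X : 𝓗 →L[ℂ] 𝓗, ((√s : ℝ) : ℂ) • (1 : 𝓗 →L[ℂ] 𝓗) * X * star (((√s : ℝ) : ℂ) • 1)
      = (s : ℂ) • X := fun X => by
    rw [star_smul, star_one, smul_mul_assoc, one_mul, smul_mul_smul_comm, mul_one,
      Complex.star_def, Complex.conj_ofReal, ← Complex.ofReal_mul, Real.mul_self_sqrt hs.le]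
  rwa [hT, hT, hT] at h

/-- Homogeneity with factor 2 forces `Λ(0, 0)` to equal its own double. -/
theorem OperatorMean.map_zero : Λ.toFun 0 0 = 0 := by
  have h := Λ.map_smul_one (s := 2) two_pos (le_refl 0) (le_refl 0)
  rw [smul_zero, show ((2 : ℝ) : ℂ) = 1 + 1 by norm_num, add_smul, one_smul] at h
  exact left_eq_add.1 h

theorem mul_eq_zero_of_conjugate_eq_zero {Z P : 𝓗 →L[ℂ] 𝓗} (hZ : 0 ≤ Z) (hP : star P = P)
    (h : P * Z * P = 0) : Z * P = 0 := by
  obtain ⟨S, rfl⟩ := CStarAlgebra.nonneg_iff_eq_star_mul_self.1 hZ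
  have : star (S * P) * (S * P) = 0 := by rw [star_mul, hP, ← h]; noncomm_ring
  rw [mul_assoc, (CStarRing.star_mul_self_eq_zero_iff _).1 this, mul_zero]

/-- The positive operator `X - P X P` has vanishing corner at `P`, hence is annihilated by `P`. -/
theorem commute_of_conjugate_le {X P : 𝓗 →L[ℂ] 𝓗} (hX : star X = X) (hP : star P = P)
    (hPP : P * P = P) (h : P * X * P ≤ X) : X * P = P * X * P ∧ P * X = P * X * P := by
  have h1 := mul_eq_zero_of_conjugate_eq_zero (sub_nonneg.2 h) hP (by
    rw [show P * (X - P * X * P) * P = P * X * P - (P * P) * X * (P * P) by noncomm_ring, hPP, sub_self])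
  rw [sub_mul, mul_assoc (P * X) P P, hPP, sub_eq_zero] at h1
  refine ⟨h1, ?_⟩
  simpa [star_mul, hX, hP, mul_assoc] using congrArg star h1

theorem nonneg_mul_projection {A P : 𝓗 →L[ℂ] 𝓗} (hA : 0 ≤ A) (hP : star P = P) (hPP : P * P = P)
    (hAP : A * P = P * A) : 0 ≤ A * P ∧ A * P ≤ A ∧ P * A * P = A * P := by
  have h1 : P * A * P = A * P := by rw [← hAP, mul_assoc, hPP]
  have h2 : (1 - P) * A * (1 - P) = A - A * P := by
    rw [show (1 - P) * A * (1 - P) = A - A * P - P * A + P * A * P by noncomm_ring, h1, ← hAP]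
    abel
  refine ⟨?_, ?_, h1⟩
  · have := star_right_conjugate_nonneg hA P
    rwa [hP, h1] at this
  · have := star_right_conjugate_nonneg hA (1 - P)
    rw [star_sub, star_one, hP, h2] at this
    exact sub_nonneg.1 this

/-- A projection that commutes with `A` and `B` commutes with `Λ(A, B)`, and cuts it down to
`Λ(A P, B P)`. -/
theorem OperatorMean.map_mul_projection {A B P : 𝓗 →L[ℂ] 𝓗} (hA : 0 ≤ A) (hB : 0 ≤ B)
    (hP : star P = P) (hPP : P * P = P) (hAP : A * P = P * A) (hBP : B * P = P * B) :
    Λ.toFun A B * P = P * Λ.toFun A B ∧ Λ.toFun (A * P) (B * P) = Λ.toFun A B * P := by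
  have hP0 : ∀ {Q : 𝓗 →L[ℂ] 𝓗}, star Q = Q → Q * Q = Q → 0 ≤ Q := fun {Q} h h' => by
    rw [← h', ← congrArg (· * Q) h]
    exact star_mul_self_nonneg Q
  obtain ⟨a1, a2, a3⟩ := nonneg_mul_projection hA hP hPP hAP
  obtain ⟨b1, b2, b3⟩ := nonneg_mul_projection hB hP hPP hBP
  set X := Λ.toFun A B with hXdef
  set Y := Λ.toFun (A * P) (B * P) with hYdef
  have hX : 0 ≤ X := Λ.nonneg _ _ hA hB
  have hY : 0 ≤ Y := Λ.nonneg _ _ a1 b1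
  have hYX : Y ≤ X := Λ.mono _ _ _ _ a1 b1 a2 b2
  have hXY : P * X * P ≤ Y := by
    have := Λ.transformer A B P hA hB (hP0 hP hPP)
    rwa [a3, b3] at this
  -- The transformer inequality and monotonicity squeeze `P X P ≤ Y ≤ X`. It remains to see that `Y`
  -- lives on the range of `P`, for then compressing `Y ≤ X` by `P` gives `Y ≤ P X P`.
  obtain ⟨x1, x2⟩ := commute_of_conjugate_le hX.isSelfAdjoint hP hPP (hXY.trans hYX)
  refine ⟨x1.trans x2.symm, ?_⟩
  have hQ : star (1 - P) = 1 - P := by rw [star_sub, star_one, hP]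
  have hQQ : (1 - P) * (1 - P) = 1 - P := by
    rw [show (1 - P) * (1 - P) = 1 - P - P + P * P by noncomm_ring, hPP]; abel
  have hz : ∀ C : 𝓗 →L[ℂ] 𝓗, (1 - P) * (C * P) * (1 - P) = 0 := fun C => by
    rw [show (1 - P) * (C * P) * (1 - P) = (1 - P) * C * (P - P * P) by noncomm_ring, hPP]; simp
  have hYQ : Y * (1 - P) = 0 := by
    refine mul_eq_zero_of_conjugate_eq_zero hY hQ (le_antisymm ?_ ?_)
    · have := Λ.transformer (A * P) (B * P) (1 - P) a1 b1 (hP0 hQ hQQ)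
      rwa [hz, hz, map_zero] at this
    · have := star_right_conjugate_nonneg hY (1 - P)
      rwa [hQ] at this
  have hYP : Y = Y * P := by
    rw [mul_sub, mul_one, sub_eq_zero] at hYQ; exact hYQ
  have hPY : Y = P * Y := by
    have := congrArg star hYP
    rw [star_mul, hP, show star Y = Y from hY.isSelfAdjoint] at this
    exact this
  have hYP' : Y = P * Y * P := by rw [← hPY, ← hYP]
  refine le_antisymm ?_ ?_
  · rw [hYP', x1]
    have := star_right_conjugate_le_conjugate hYX P
    rwa [hP] at this
  · rw [x1]
    exact hXY

/-- Commuting with the projection onto the line of `x` makes `x` an eigenvector. An operator for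
which every vector is an eigenvector is scalar. -/
theorem exists_eq_smul_one_of_commute {X : 𝓗 →L[ℂ] 𝓗}
    (h : ∀ P : 𝓗 →L[ℂ] 𝓗, star P = P → P * P = P → X * P = P * X) : ∃ c : ℂ, X = c • 1 := by
  have := LinearMap.exists_eq_smul_id_of_forall_notLinearIndependent (R := ℂ)
    (f := (X : 𝓗 →ₗ[ℂ] 𝓗)) fun x hx => by
      set K := Submodule.span ℂ {x}
      have hP := h K.starProjection (isSelfAdjoint_starProjection K)
        (Submodule.isIdempotentElem_starProjection K)
      have h1 : X x ∈ K := by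
        have h2 := congrArg (fun T : 𝓗 →L[ℂ] 𝓗 => T x) hP
        simp only [mul_apply_eq_comp] at h2
        rw [Submodule.starProjection_eq_self_iff.2 (Submodule.mem_span_singleton_self x)] at h2
        rw [h2]
        exact Submodule.starProjection_apply_mem K _
      obtain ⟨c, hc⟩ := Submodule.mem_span_singleton.1 h1
      rw [LinearIndependent.pair_iff] at hx
      have := hx c (-1) (by simp [hc])
      simp at this
  obtain ⟨c, hc⟩ := this
  exact ⟨c, ContinuousLinearMap.coe_injective hc⟩

/-- The mean of two scalars commutes with every projection by `map_mul_projection`, so it is scalar.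
The diagonal value comes from homogeneity and `Λ(1, 1) = 1`; it is imposed for negative `r` too, as
a harmless default. -/
theorem OperatorMean.exists_scalar (Λ : OperatorMean 𝓗) :
    ∃ c : ℝ → ℝ → ℂ, (∀ r, c r r = r) ∧
      ∀ r s : ℝ, 0 ≤ r → 0 ≤ s → Λ.toFun ((r : ℂ) • 1) ((s : ℂ) • 1) = c r s • 1 := by
  have h : ∀ r s : ℝ, ∃ c : ℂ, (r = s → c = r) ∧
      (0 ≤ r → 0 ≤ s → Λ.toFun ((r : ℂ) • 1) ((s : ℂ) • 1) = c • 1) := by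
    intro r s
    by_cases hrs : r = s
    · subst hrs
      refine ⟨r, fun _ => rfl, fun hr _ => ?_⟩
      rcases hr.eq_or_lt with rfl | hr
      · simp [map_zero]
      · rw [map_smul_one hr zero_le_one zero_le_one, Λ.map_one]
    · by_cases h0 : 0 ≤ r ∧ 0 ≤ s
      · obtain ⟨c, hc⟩ := exists_eq_smul_one_of_commute fun P hP hPP =>
          (map_mul_projection (Λ := Λ) (smul_one_nonneg h0.1) (smul_one_nonneg h0.2) hP hPP
            (by simp) (by simp)).1
        exact ⟨c, fun h => absurd h hrs, fun _ _ => hc⟩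
      · exact ⟨0, fun h => absurd h hrs, fun h1 h2 => absurd ⟨h1, h2⟩ h0⟩
  choose c hc hc' using h
  exact ⟨c, fun r => hc r r rfl, hc'⟩

end OperatorMeans

/-! ### Operator means of compressions -/

section Compression

variable {𝓗 : Type*} [NormedAddCommGroup 𝓗] [InnerProductSpace ℂ 𝓗] [CompleteSpace 𝓗]
  {E : Type*} [NormedAddCommGroup E] [InnerProductSpace ℂ E] [CompleteSpace E]
  {Λ : OperatorMean 𝓗}

/-- `W A W*`. -/
noncomputable def lift (W : E →L[ℂ] 𝓗) (A : E →L[ℂ] E) : 𝓗 →L[ℂ] 𝓗 := W ∘L A ∘L W.adjoint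

theorem lift_nonneg (W : E →L[ℂ] 𝓗) {A : E →L[ℂ] E} (hA : 0 ≤ A) : 0 ≤ lift W A := by
  rw [ContinuousLinearMap.nonneg_iff_isPositive] at hA ⊢
  exact hA.conj_adjoint W

theorem star_lift (W : E →L[ℂ] 𝓗) (A : E →L[ℂ] E) : star (lift W A) = lift W (star A) := by
  simp only [lift, ContinuousLinearMap.star_eq_adjoint, ContinuousLinearMap.adjoint_comp,
    ContinuousLinearMap.adjoint_adjoint, ContinuousLinearMap.comp_assoc]

theorem adjoint_comp_cancel {W : E →L[ℂ] 𝓗} (hW : W.adjoint ∘L W = 1) {F : Type*}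
    [NormedAddCommGroup F] [InnerProductSpace ℂ F] (X : F →L[ℂ] E) :
    W.adjoint ∘L W ∘L X = X := by
  rw [← ContinuousLinearMap.comp_assoc, hW]
  rfl

theorem lift_mul {W : E →L[ℂ] 𝓗} (hW : W.adjoint ∘L W = 1) (A B : E →L[ℂ] E) :
    lift W A * lift W B = lift W (A * B) := by
  simp only [lift, ContinuousLinearMap.mul_def, ContinuousLinearMap.comp_assoc,
    adjoint_comp_cancel hW]

theorem adjoint_lift_comp {W : E →L[ℂ] 𝓗} (hW : W.adjoint ∘L W = 1) (A : E →L[ℂ] E) :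
    W.adjoint ∘L lift W A ∘L W = A := by
  simp only [lift, ContinuousLinearMap.comp_assoc, adjoint_comp_cancel hW, hW]
  rfl

theorem lift_comp_self {W : E →L[ℂ] 𝓗} (hW : W.adjoint ∘L W = 1) (A : E →L[ℂ] E) :
    lift W A ∘L W = W ∘L A := by
  simp only [lift, ContinuousLinearMap.comp_assoc, hW]
  rfl

/-- The operator mean of `A` and `B`, computed through `W`. -/
noncomputable def OperatorMean.compress (Λ : OperatorMean 𝓗) (W : E →L[ℂ] 𝓗)
    (A B : E →L[ℂ] E) : E →L[ℂ] E :=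
  W.adjoint ∘L Λ.toFun (lift W A) (lift W B) ∘L W

theorem OperatorMean.compress_nonneg (W : E →L[ℂ] 𝓗) {A B : E →L[ℂ] E} (hA : 0 ≤ A) (hB : 0 ≤ B) :
    0 ≤ Λ.compress W A B := by
  have := Λ.nonneg _ _ (lift_nonneg W hA) (lift_nonneg W hB)
  rw [ContinuousLinearMap.nonneg_iff_isPositive] at this ⊢
  exact this.adjoint_conj W

/-- On a joint eigenspace of `A` and `B` the mean is the scalar mean of the eigenvalues, since the
lifted operators and the scalars `r`, `s` have the same cut-downs by the lift of `Q`. -/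
theorem OperatorMean.compress_mul_projection {W : E →L[ℂ] 𝓗} (hW : W.adjoint ∘L W = 1)
    {c : ℝ → ℝ → ℂ}
    (hc : ∀ r s : ℝ, 0 ≤ r → 0 ≤ s → Λ.toFun ((r : ℂ) • 1) ((s : ℂ) • 1) = c r s • 1)
    {A B Q : E →L[ℂ] E} (hA : 0 ≤ A) (hB : 0 ≤ B) (hQ : star Q = Q) (hQQ : Q * Q = Q)
    {r s : ℝ} (hr : 0 ≤ r) (hs : 0 ≤ s) (hAQ : A * Q = (r : ℂ) • Q) (hQA : Q * A = (r : ℂ) • Q)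
    (hBQ : B * Q = (s : ℂ) • Q) (hQB : Q * B = (s : ℂ) • Q) :
    Λ.compress W A B * Q = c r s • Q := by
  have hlift : ∀ z : ℂ, lift W (z • Q) = z • 1 * lift W Q := fun z => by
    ext x
    simp [lift]
  have hP : star (lift W Q) = lift W Q := by rw [star_lift, hQ]
  have hPP : lift W Q * lift W Q = lift W Q := by rw [lift_mul hW, hQQ]
  have h1 := (map_mul_projection (Λ := Λ) (lift_nonneg W hA) (lift_nonneg W hB) hP hPP
    (by rw [lift_mul hW, lift_mul hW, hAQ, hQA]) (by rw [lift_mul hW, lift_mul hW, hBQ, hQB])).2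
  have h2 := (map_mul_projection (Λ := Λ) (smul_one_nonneg hr) (smul_one_nonneg hs) hP hPP
    (by simp) (by simp)).2
  rw [lift_mul hW, lift_mul hW, hAQ, hBQ, hlift, hlift, h2, hc r s hr hs] at h1
  have h3 : Λ.compress W A B * Q
      = W.adjoint ∘L (Λ.toFun (lift W A) (lift W B) * lift W Q) ∘L W := by
    simp only [compress, ContinuousLinearMap.mul_def, ContinuousLinearMap.comp_assoc,
      lift_comp_self hW]
  rw [h3, ← h1, ← hlift, adjoint_lift_comp hW]

/-- Two embeddings with orthogonal ranges generate `2 × 2` matrix units. The right-angle rotation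
`J` in them carries `V` to `T`, and the mean is covariant under `J`. -/
theorem OperatorMean.compress_eq_of_orthogonal {V T : E →L[ℂ] 𝓗} (hV : V.adjoint ∘L V = 1)
    (hT : T.adjoint ∘L T = 1) (hTV : T.adjoint ∘L V = 0) {A B : E →L[ℂ] E} (hA : 0 ≤ A)
    (hB : 0 ≤ B) : Λ.compress T A B = Λ.compress V A B := by
  have hVT : V.adjoint ∘L T = 0 := by
    have := congrArg ContinuousLinearMap.adjoint hTV
    simpa [ContinuousLinearMap.adjoint_comp] using this
  set X : Fin 2 → E →L[ℂ] 𝓗 := ![V, T] with hX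
  have hXX : ∀ j k, (X j).adjoint ∘L X k = if j = k then 1 else 0 := by
    intro j k
    fin_cases j <;> fin_cases k <;> simp [hX, hV, hT, hTV, hVT]
  set e : Fin 2 → Fin 2 → 𝓗 →L[ℂ] 𝓗 := fun i j => X i ∘L (X j).adjoint with he
  have hee : ∀ i j k l, e i j * e k l = if j = k then e i l else 0 := by
    intro i j k l
    have : e i j * e k l = X i ∘L ((X j).adjoint ∘L X k) ∘L (X l).adjoint := by
      simp only [he, ContinuousLinearMap.mul_def, ContinuousLinearMap.comp_assoc]
    rw [this, hXX]
    split_ifs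
    · rfl
    · simp
  have hes : ∀ i j, star (e i j) = e j i := by
    intro i j
    simp only [he, ContinuousLinearMap.star_eq_adjoint, ContinuousLinearMap.adjoint_comp,
      ContinuousLinearMap.adjoint_adjoint]
  have heX : ∀ i j k, e i j ∘L X k = if j = k then X i else 0 := by
    intro i j k
    simp only [he, ContinuousLinearMap.comp_assoc, hXX]
    split_ifs
    · rfl
    · simp
  set J := unitBlock e !![0, -1; 1, 0] with hJ
  have hJV : J ∘L V = T := by
    have h0 : ∀ i j, e i j ∘L V = if j = 0 then X i else 0 := fun i j => heX i j 0
    simp [hJ, unitBlock, Fin.sum_univ_two, ContinuousLinearMap.add_comp,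
      ContinuousLinearMap.neg_comp, h0]
    simp only [hX, Matrix.cons_val_zero, Matrix.cons_val_one]
    rw [show (1 : 𝓗 →L[ℂ] 𝓗) ∘L V = V from rfl]
    abel
  have hJJ : star J * J = 1 := by
    rw [hJ, star_unitBlock hes, unitBlock_mul hee, ← unitBlock_one (e := e)]
    congr 1
    ext i j
    fin_cases i <;> fin_cases j <;> simp [Matrix.mul_apply, Fin.sum_univ_two, Matrix.star_apply]
  have hJT : star J ∘L T = V := by
    rw [← hJV, ← ContinuousLinearMap.comp_assoc, ← ContinuousLinearMap.mul_def, hJJ]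
    rfl
  have hTJ : T.adjoint ∘L J = V.adjoint := by
    rw [← hJT, ContinuousLinearMap.adjoint_comp, ContinuousLinearMap.star_eq_adjoint,
      ContinuousLinearMap.adjoint_adjoint]
  have hl : ∀ C : E →L[ℂ] E, lift T C = J * lift V C * star J := fun C => by
    rw [← hJV]
    simp only [lift, ContinuousLinearMap.mul_def, ContinuousLinearMap.comp_assoc,
      ContinuousLinearMap.adjoint_comp, ContinuousLinearMap.star_eq_adjoint]
  rw [compress, hl, hl, covariant_unitBlock_rotation hee hes _ _ (lift_nonneg V hA)
    (lift_nonneg V hB), ← hJ]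
  simp only [ContinuousLinearMap.mul_def, ContinuousLinearMap.comp_assoc, hJT]
  rw [← ContinuousLinearMap.comp_assoc, hTJ]
  rfl

theorem exists_isometry_orthogonal [FiniteDimensional ℂ E] (h𝓗 : ¬ FiniteDimensional ℂ 𝓗)
    (S : Submodule ℂ 𝓗) [FiniteDimensional ℂ S] :
    ∃ V : E →ₗᵢ[ℂ] 𝓗, ∀ x, V x ∈ Sᗮ := by
  have hS : ¬ FiniteDimensional ℂ Sᗮ := fun h => h𝓗 <| by
    have := Submodule.finiteDimensional_sup S Sᗮ
    rw [Submodule.sup_orthogonal_of_hasOrthogonalProjection] at this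
    exact Module.finite_def.2 ((Submodule.fg_iff_finiteDimensional _).2 this)
  obtain ⟨f, hf⟩ := exists_linearIndependent_of_le_rank (R := ℂ) (M := Sᗮ)
    (n := Module.finrank ℂ E) (by
      have := Module.rank_lt_aleph0_iff (R := ℂ) (M := Sᗮ) |>.not.2 hS
      exact Cardinal.natCast_lt_aleph0.le.trans (not_lt.1 this))
  have ho := InnerProductSpace.gramSchmidtNormed_orthonormal hf
  set b := stdOrthonormalBasis ℂ E
  set g : E →ₗ[ℂ] Sᗮ := b.toBasis.constr ℂ (InnerProductSpace.gramSchmidtNormed ℂ f) with hg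
  have hgo : Orthonormal ℂ (g ∘ b.toBasis) := by
    rwa [show g ∘ b.toBasis = InnerProductSpace.gramSchmidtNormed ℂ f from
      funext fun i => by simp [hg]]
  have hb : Orthonormal ℂ b.toBasis := by
    rw [b.coe_toBasis]
    exact b.orthonormal
  exact ⟨Sᗮ.subtypeₗᵢ.comp (g.isometryOfOrthonormal hb hgo), fun x => (g x).2⟩

theorem adjoint_comp_self_of_isometry (V : E →ₗᵢ[ℂ] 𝓗) :
    V.toContinuousLinearMap.adjoint ∘L V.toContinuousLinearMap = 1 := by
  refine ContinuousLinearMap.ext fun x => ext_inner_left ℂ fun y => ?_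
  simp

theorem adjoint_comp_eq_zero {V T : E →L[ℂ] 𝓗} (h : ∀ x y, inner ℂ (T x) (V y) = 0) :
    T.adjoint ∘L V = 0 := by
  refine ContinuousLinearMap.ext fun x => ext_inner_left ℂ fun y => ?_
  simp [ContinuousLinearMap.adjoint_inner_right, h]

theorem exists_orthogonal_copies [FiniteDimensional ℂ E] (h𝓗 : ¬ FiniteDimensional ℂ 𝓗) (N : ℕ) :
    ∀ (S : Submodule ℂ 𝓗) [FiniteDimensional ℂ S], ∃ U : Fin N → E →L[ℂ] 𝓗,
      (∀ m n, (U m).adjoint ∘L U n = if m = n then 1 else 0) ∧ ∀ n x, U n x ∈ Sᗮ := by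
  induction N with
  | zero => exact fun S _ => ⟨fun n => n.elim0, fun n => n.elim0, fun n => n.elim0⟩
  | succ N ih =>
    intro S _
    obtain ⟨V, hV⟩ := exists_isometry_orthogonal (E := E) h𝓗 S
    -- The remaining copies must avoid the range of the new one as well, which is why `S` is
    -- quantified inside the induction.
    obtain ⟨U, hU, hUS⟩ := ih (S ⊔ LinearMap.range V.toLinearMap)
    have hVU : ∀ n x y, inner ℂ (V x) (U n y) = 0 := fun n x y =>
      (Submodule.mem_orthogonal _ _).1 (hUS n y) _ (Submodule.mem_sup_right ⟨x, rfl⟩)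
    refine ⟨Fin.cons V.toContinuousLinearMap U, ?_, ?_⟩
    · intro m n
      refine Fin.cases ?_ (fun m => ?_) m <;> refine Fin.cases ?_ (fun n => ?_) n
      · simp
      · simpa only [Fin.cons_zero, Fin.cons_succ, (Fin.succ_ne_zero n).symm, if_false] using
          adjoint_comp_eq_zero (T := V.toContinuousLinearMap) (V := U n) fun x y => hVU n x y
      · simpa using adjoint_comp_eq_zero (V := V.toContinuousLinearMap) (T := U m)
          fun x y => inner_eq_zero_symm.1 (hVU m y x)
      · simpa using hU m n
    · intro n
      refine Fin.cases (fun x => hV x) (fun n x => ?_) n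
      exact Submodule.orthogonal_le le_sup_left (hUS n x)

theorem compress_le_compress {W : E →L[ℂ] 𝓗} {X Y : 𝓗 →L[ℂ] 𝓗} (h : X ≤ Y) :
    W.adjoint ∘L X ∘L W ≤ W.adjoint ∘L Y ∘L W := by
  rw [ContinuousLinearMap.le_def] at h ⊢
  simpa [ContinuousLinearMap.comp_sub, ContinuousLinearMap.sub_comp] using h.adjoint_conj W

/-- Operator means are superadditive along families `D` with `∑ n, (D n)* (D n) = 1`. -/
theorem OperatorMean.sum_compress_le [FiniteDimensional ℂ E] (h𝓗 : ¬ FiniteDimensional ℂ 𝓗)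
    {V : E →L[ℂ] 𝓗} (hV : V.adjoint ∘L V = 1) {N : ℕ} (D : Fin N → E →L[ℂ] E)
    (hD : ∑ n, star (D n) * D n = 1) {A B : E →L[ℂ] E} (hA : 0 ≤ A) (hB : 0 ≤ B) :
    ∑ n, star (D n) * Λ.compress V A B * D n
      ≤ Λ.compress V (∑ n, star (D n) * A * D n) (∑ n, star (D n) * B * D n) := by
  -- Infinite dimension provides room for `N` orthogonal copies of `E`, also orthogonal to the range
  -- of `V`. Then `T = ∑ U n D n` is an isometry, and compressing a direct sum of copies of `A` by
  -- `T` yields `∑ (D n)* A (D n)`.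
  obtain ⟨U, hU, hUV⟩ := exists_orthogonal_copies (E := E) h𝓗 N (LinearMap.range (V : E →ₗ[ℂ] 𝓗))
  have hUn : ∀ n, (U n).adjoint ∘L U n = 1 := fun n => by simp [hU]
  have hUV0 : ∀ n, (U n).adjoint ∘L V = 0 := fun n => adjoint_comp_eq_zero fun x y =>
    inner_eq_zero_symm.1 ((Submodule.mem_orthogonal _ _).1 (hUV n x) _ ⟨y, rfl⟩)
  have hUmn : ∀ m n (X : E →L[ℂ] E), (U m).adjoint ∘L U n ∘L X = if m = n then X else 0 := by
    intro m n X
    rw [← ContinuousLinearMap.comp_assoc, hU]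
    split_ifs
    · rfl
    · simp
  have hUmn' : ∀ m n (X : 𝓗 →L[ℂ] E), (U m).adjoint ∘L U n ∘L X = if m = n then X else 0 := by
    intro m n X
    rw [← ContinuousLinearMap.comp_assoc, hU]
    split_ifs
    · rfl
    · simp
  set T : E →L[ℂ] 𝓗 := ∑ n, U n ∘L D n with hTdef
  have hTapp : ∀ x, T x = ∑ n, U n (D n x) := fun x => by simp [hTdef, sum_apply]
  have hTadj : ∀ x, T.adjoint x = ∑ n, star (D n) ((U n).adjoint x) := fun x => by
    simp [hTdef, sum_apply, map_sum, ContinuousLinearMap.adjoint_comp,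
      ContinuousLinearMap.star_eq_adjoint]
  have hsand : ∀ (Z : 𝓗 →L[ℂ] 𝓗) (Z' : E →L[ℂ] E),
      (∀ m n, (U m).adjoint ∘L Z ∘L U n = if m = n then Z' else 0) →
      T.adjoint ∘L Z ∘L T = ∑ n, star (D n) * Z' * D n := by
    intro Z Z' h
    ext x
    have h' : ∀ m n y, (U m).adjoint (Z (U n y)) = if m = n then Z' y else 0 := fun m n y => by
      have := congrArg (fun L : E →L[ℂ] E => L y) (h m n)
      simp only [ContinuousLinearMap.comp_apply] at this
      rw [this]
      split_ifs <;> rfl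
    simp [hTadj, hTapp, map_sum, h', sum_apply]
  have hT : T.adjoint ∘L T = 1 := by
    rw [← hD]
    have := hsand 1 1 fun m n => hU m n
    simp only [mul_one] at this
    exact this
  have hTV : T.adjoint ∘L V = 0 := adjoint_comp_eq_zero fun x y => by
    rw [hTapp, sum_inner]
    exact Finset.sum_eq_zero fun n _ =>
      inner_eq_zero_symm.1 ((Submodule.mem_orthogonal _ _).1 (hUV n (D n x)) _ ⟨y, rfl⟩)
  set S : (E →L[ℂ] E) → 𝓗 →L[ℂ] 𝓗 := fun C => ∑ n, lift (U n) C with hS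
  have hS0 : ∀ {C}, 0 ≤ C → 0 ≤ S C := fun hC => Finset.sum_nonneg fun n _ => lift_nonneg _ hC
  have hll : ∀ m n C C', lift (U m) C * lift (U n) C' = if m = n then lift (U n) (C * C') else 0 := by
    intro m n C C'
    rcases eq_or_ne m n with rfl | h
    · rw [if_pos rfl, lift_mul (hUn m)]
    · simp only [lift, ContinuousLinearMap.mul_def, ContinuousLinearMap.comp_assoc, hUmn', if_neg h,
        ContinuousLinearMap.comp_zero]
  have hSP : ∀ C n, S C * lift (U n) 1 = lift (U n) C := fun C n => by
    simp [hS, Finset.sum_mul, hll]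
  have hPS : ∀ C n, lift (U n) 1 * S C = lift (U n) C := fun C n => by
    simp [hS, Finset.mul_sum, hll]
  have hSU : ∀ C m n, (U m).adjoint ∘L S C ∘L U n = if m = n then C else 0 := by
    intro C m n
    have h1 : S C ∘L U n = U n ∘L C := by
      have h2 : S C ∘L U n = (S C * lift (U n) 1) ∘L U n := by
        rw [ContinuousLinearMap.mul_def, ContinuousLinearMap.comp_assoc, lift_comp_self (hUn n)]
        rfl
      rw [h2, hSP, lift_comp_self (hUn n)]
    rw [h1, hUmn]
  set X := Λ.toFun (S A) (S B) with hX
  have hPst : ∀ n, star (lift (U n) 1) = lift (U n) 1 := fun n => by rw [star_lift, star_one]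
  have hPsq : ∀ n, lift (U n) 1 * lift (U n) 1 = lift (U n) 1 := fun n => by
    rw [lift_mul (hUn n), one_mul]
  -- The mean of the direct sums is the direct sum of the means: it commutes with the projections
  -- onto the copies, and on each copy it agrees with the mean computed through `V`.
  have hXU : ∀ m n, (U m).adjoint ∘L X ∘L U n = if m = n then Λ.compress V A B else 0 := by
    intro m n
    obtain ⟨h1, h2⟩ := map_mul_projection (Λ := Λ) (hS0 hA) (hS0 hB) (hPst n) (hPsq n)
      (by rw [hSP, hPS]) (by rw [hSP, hPS])
    rw [hSP, hSP, ← hX] at h2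
    rw [← hX] at h1
    have h3 : X ∘L U n = (X * lift (U n) 1) ∘L U n := by
      rw [ContinuousLinearMap.mul_def, ContinuousLinearMap.comp_assoc, lift_comp_self (hUn n)]
      rfl
    rw [h3]
    split_ifs with h
    · subst h
      rw [← h2, ← compress_eq_of_orthogonal hV (hUn m) (hUV0 m) hA hB]
      rfl
    · rw [h1]
      simp only [lift, ContinuousLinearMap.mul_def, ContinuousLinearMap.comp_assoc, hUmn, if_neg h]
  set P := lift T 1 with hP
  have hPP : P * P = P := by rw [hP, lift_mul hT, one_mul]
  have hPs : star P = P := by rw [hP, star_lift, star_one]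
  have hP0 : 0 ≤ P := lift_nonneg T zero_le_one
  have hPZ : ∀ Z : 𝓗 →L[ℂ] 𝓗, P * Z * P = lift T (T.adjoint ∘L Z ∘L T) := fun Z => by
    simp only [hP, lift, ContinuousLinearMap.mul_def, ContinuousLinearMap.comp_assoc]
    rfl
  -- The transformer inequality for the projection `P = T T*` is the claimed inequality, read
  -- through `T`; orthogonality of `T` and `V` replaces `T` by `V`.
  have h1 := Λ.transformer (S A) (S B) P (hS0 hA) (hS0 hB) hP0
  rw [hPZ, hPZ, hPZ, hsand _ _ (hSU A), hsand _ _ (hSU B), hsand _ _ hXU] at h1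
  have h2 := compress_le_compress (W := T) h1
  rw [adjoint_lift_comp hT] at h2
  have hsum0 : ∀ {C : E →L[ℂ] E}, 0 ≤ C → 0 ≤ ∑ n, star (D n) * C * D n := fun hC =>
    Finset.sum_nonneg fun n _ => star_left_conjugate_nonneg hC (D n)
  rw [← compress_eq_of_orthogonal hV hT hTV (hsum0 hA) (hsum0 hB)]
  exact h2

end Compression

/-! ### Left and right multiplication, spectral projections -/

section Multiplication

variable {ι : Type*} [Fintype ι] [DecidableEq ι]

theorem leftMul_vec (ρ x : Matrix ι ι ℂ) : leftMul ρ (vec x) = vec (ρ * x) := rfl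

theorem rightMul_vec (ρ x : Matrix ι ι ℂ) : rightMul ρ (vec x) = vec (x * ρ) := rfl

theorem inner_vec (x y : Matrix ι ι ℂ) : inner ℂ (vec x) (vec y) = (star x * y).trace := by
  simp only [vec, PiLp.inner_apply,
    Fintype.sum_prod_type, Matrix.trace, Matrix.diag, Matrix.mul_apply, Matrix.star_apply]
  rw [Finset.sum_comm]
  exact Finset.sum_congr rfl fun i _ => Finset.sum_congr rfl fun j _ => mul_comm _ _

theorem clm_ext_vec {A B : EuclideanSpace ℂ (ι × ι) →L[ℂ] EuclideanSpace ℂ (ι × ι)}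
    (h : ∀ x, A (vec x) = B (vec x)) : A = B := by
  refine ContinuousLinearMap.ext fun f => ?_
  rw [← vec.apply_symm_apply f]
  exact h _

theorem leftMul_mul (x y : Matrix ι ι ℂ) : leftMul (x * y) = leftMul x * leftMul y :=
  clm_ext_vec fun z => congrArg vec (mul_assoc x y z)

theorem rightMul_mul (x y : Matrix ι ι ℂ) : rightMul (x * y) = rightMul y * rightMul x :=
  clm_ext_vec fun z => congrArg vec (mul_assoc z x y).symm

theorem leftMul_mul_rightMul (x y : Matrix ι ι ℂ) :
    leftMul x * rightMul y = rightMul y * leftMul x :=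
  clm_ext_vec fun z => congrArg vec (mul_assoc x z y).symm

theorem star_leftMul (x : Matrix ι ι ℂ) : star (leftMul x) = leftMul (star x) := by
  rw [ContinuousLinearMap.star_eq_adjoint, eq_comm, ContinuousLinearMap.eq_adjoint_iff]
  intro f g
  rw [← vec.apply_symm_apply f, ← vec.apply_symm_apply g, leftMul_vec, leftMul_vec, inner_vec,
    inner_vec, star_mul, star_star, mul_assoc]

theorem star_rightMul (x : Matrix ι ι ℂ) : star (rightMul x) = rightMul (star x) := by
  rw [ContinuousLinearMap.star_eq_adjoint, eq_comm, ContinuousLinearMap.eq_adjoint_iff]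
  intro f g
  rw [← vec.apply_symm_apply f, ← vec.apply_symm_apply g, rightMul_vec, rightMul_vec, inner_vec,
    inner_vec, star_mul, star_star, mul_assoc, Matrix.trace_mul_comm, mul_assoc]

theorem leftMul_nonneg {ρ : Matrix ι ι ℂ} (hρ : ρ.PosSemidef) : 0 ≤ leftMul ρ := by
  obtain ⟨S, rfl⟩ := CStarAlgebra.nonneg_iff_eq_star_mul_self.1 hρ.nonneg
  rw [leftMul_mul, ← star_leftMul]
  exact star_mul_self_nonneg _

theorem rightMul_nonneg {ρ : Matrix ι ι ℂ} (hρ : ρ.PosSemidef) : 0 ≤ rightMul ρ := by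
  obtain ⟨S, rfl⟩ := CStarAlgebra.nonneg_iff_eq_star_mul_self.1 hρ.nonneg
  rw [rightMul_mul, ← star_rightMul]
  exact mul_star_self_nonneg _

/-- The spectral projections of a positive element of `M` belong to `M`. -/
theorem exists_spectral_projections (M : StarSubalgebra ℂ (Matrix ι ι ℂ)) {ρ : Matrix ι ι ℂ}
    (hM : ρ ∈ M) (hρ : ρ.PosSemidef) :
    ∃ (σ : Finset ℝ) (p : ℝ → Matrix ι ι ℂ), (∀ s ∈ σ, 0 ≤ s) ∧ (∀ s ∈ σ, p s ∈ M) ∧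
      (∀ s, star (p s) = p s) ∧ (∀ s s', p s * p s' = if s = s' then p s else 0) ∧
      ∑ s ∈ σ, p s = 1 ∧ (∀ s, ρ * p s = (s : ℂ) • p s) ∧ ∀ s, p s * ρ = (s : ℂ) • p s := by
  set lam := hρ.isHermitian.eigenvalues
  set U := hρ.isHermitian.eigenvectorUnitary
  set Φ : (ι → ℂ) →ₐ[ℂ] Matrix ι ι ℂ :=
    ((Unitary.conjStarAlgAut ℂ _ U : Matrix ι ι ℂ ≃⋆ₐ[ℂ] Matrix ι ι ℂ) :
      Matrix ι ι ℂ →ₐ[ℂ] Matrix ι ι ℂ).comp (Matrix.diagonalAlgHom ℂ) with hΦ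
  have hΦρ : Φ (fun i => (lam i : ℂ)) = ρ := hρ.isHermitian.spectral_theorem.symm
  have hΦs : ∀ f, star (Φ f) = Φ (star f) := fun f => by
    have : Φ f = Unitary.conjStarAlgAut ℂ _ U (Matrix.diagonal f) := rfl
    rw [this, ← map_star, Matrix.star_eq_conjTranspose, Matrix.diagonal_conjTranspose]
    rfl
  set χ : ℝ → ι → ℂ := fun s i => if lam i = s then 1 else 0 with hχ
  refine ⟨Finset.univ.image lam, fun s => Φ (χ s), ?_, ?_, ?_, ?_, ?_, ?_, ?_⟩
  · intro s hs
    obtain ⟨i, -, rfl⟩ := Finset.mem_image.1 hs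
    exact hρ.eigenvalues_nonneg i
  · intro s hs
    -- On the spectrum, the indicator of `s` is a Lagrange interpolation polynomial, so the
    -- projection is a polynomial in `ρ`.
    have h1 : χ s = Polynomial.aeval (fun i => (lam i : ℂ))
        (Lagrange.basis (Finset.univ.image lam) (fun r : ℝ => (r : ℂ)) s) := by
      funext i
      rw [Polynomial.aeval_pi_apply₂, Polynomial.coe_aeval_eq_eval]
      by_cases h : lam i = s
      · rw [h, Lagrange.eval_basis_self (fun x _ y _ hxy => Complex.ofReal_injective hxy) hs]
        simp [hχ, h]
      · rw [Lagrange.eval_basis_of_ne (Ne.symm h) (Finset.mem_image_of_mem _ (Finset.mem_univ i))]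
        simp [hχ, h]
    show Φ (χ s) ∈ M
    rw [h1, ← Polynomial.aeval_algHom_apply, hΦρ]
    exact Algebra.adjoin_le (S := M.toSubalgebra) (Set.singleton_subset_iff.2 hM)
      (Polynomial.aeval_mem_adjoin_singleton ℂ ρ)
  · intro s
    rw [hΦs]
    congr 1
    funext i
    simp [hχ]
  · intro s s'
    rw [← map_mul]
    split_ifs with h
    · subst h
      congr 1
      funext i
      simp [hχ]
    · convert map_zero Φ
      funext i
      simp only [hχ, Pi.mul_apply, Pi.zero_apply]
      split_ifs with h1 h2 <;> simp
      exact h (h1.symm.trans h2)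
  · rw [← map_sum, ← map_one Φ]
    congr 1
    funext i
    simp [hχ, Finset.sum_apply]
  · intro s
    rw [← hΦρ, ← map_mul, ← map_smul]
    congr 1
    funext i
    simp only [hχ, Pi.mul_apply, Pi.smul_apply, smul_eq_mul]
    split_ifs with h <;> simp [h]
  · intro s
    rw [← hΦρ, ← map_mul, ← map_smul]
    congr 1
    funext i
    simp only [hχ, Pi.mul_apply, Pi.smul_apply, smul_eq_mul]
    split_ifs with h <;> simp [h]

end Multiplication

section MeanOfMultiplications

variable {𝓗 : Type*} [NormedAddCommGroup 𝓗] [InnerProductSpace ℂ 𝓗] [CompleteSpace 𝓗]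
  {Λ : OperatorMean 𝓗} {ι : Type*} [Fintype ι] [DecidableEq ι]

/-- The operator mean of left and right multiplication by `ρ`. -/
noncomputable def OperatorMean.meanMul (Λ : OperatorMean 𝓗) (V : EuclideanSpace ℂ (ι × ι) →ₗᵢ[ℂ] 𝓗)
    (ρ : Matrix ι ι ℂ) : EuclideanSpace ℂ (ι × ι) →L[ℂ] EuclideanSpace ℂ (ι × ι) :=
  Λ.onSubspace V (leftMul ρ) (rightMul ρ)

theorem OperatorMean.meanMul_nonneg (V : EuclideanSpace ℂ (ι × ι) →ₗᵢ[ℂ] 𝓗) {ρ : Matrix ι ι ℂ}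
    (hρ : ρ.PosSemidef) : 0 ≤ Λ.meanMul V ρ :=
  compress_nonneg _ (leftMul_nonneg hρ) (rightMul_nonneg hρ)

/-- The products `L(p s) R(p s')` are joint spectral projections of `L(ρ)` and `R(ρ)`, so `ρ̂` acts
on each by a scalar `c s s'`. Only the diagonal `c s s = s` survives at the identity, whence `ρ̂ 1 =
ρ`. -/
theorem OperatorMean.exists_meanMul_expansion (Λ : OperatorMean 𝓗)
    (V : EuclideanSpace ℂ (ι × ι) →ₗᵢ[ℂ] 𝓗) (M : StarSubalgebra ℂ (Matrix ι ι ℂ)) {ρ : Matrix ι ι ℂ}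
    (hM : ρ ∈ M) (hρ : ρ.PosSemidef) :
    ∃ (σ : Finset ℝ) (p : ℝ → Matrix ι ι ℂ) (c : ℝ → ℝ → ℂ), (∀ s ∈ σ, p s ∈ M) ∧
      (∀ x, Λ.meanMul V ρ (vec x)
        = ∑ s ∈ σ, ∑ s' ∈ σ, c s s' • vec (p s * x * p s')) ∧ Λ.meanMul V ρ (vec 1) = vec ρ := by
  obtain ⟨c, hcc, hc⟩ := Λ.exists_scalar
  obtain ⟨σ, p, hσ, hpM, hps, hpp, hp1, hρp, hpρ⟩ := exists_spectral_projections M hM hρ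
  have key : ∀ s ∈ σ, ∀ s' ∈ σ, Λ.meanMul V ρ * (leftMul (p s) * rightMul (p s'))
      = c s s' • (leftMul (p s) * rightMul (p s')) := by
    intro s hs s' hs'
    refine compress_mul_projection (adjoint_comp_self_of_isometry V) hc (leftMul_nonneg hρ)
      (rightMul_nonneg hρ) ?_ ?_ (hσ s hs) (hσ s' hs') ?_ ?_ ?_ ?_
    · rw [star_mul, star_leftMul, star_rightMul, hps, hps, leftMul_mul_rightMul]
    all_goals
      refine clm_ext_vec fun x => ?_
    · show vec (p s * ((p s * (x * p s')) * p s')) = vec (p s * (x * p s'))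
      congr 1
      rw [show p s * ((p s * (x * p s')) * p s') = (p s * p s) * x * (p s' * p s') by noncomm_ring,
        hpp, hpp, if_pos rfl, if_pos rfl, mul_assoc]
    · show vec (ρ * (p s * (x * p s'))) = (s : ℂ) • vec (p s * (x * p s'))
      rw [← mul_assoc, hρp, smul_mul_assoc, map_smul]
    · show vec (p s * ((ρ * x) * p s')) = (s : ℂ) • vec (p s * (x * p s'))
      rw [mul_assoc ρ, ← mul_assoc (p s), hpρ, smul_mul_assoc, map_smul]
    · show vec ((p s * (x * p s')) * ρ) = (s' : ℂ) • vec (p s * (x * p s'))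
      rw [mul_assoc, mul_assoc x, hpρ, mul_smul_comm, mul_smul_comm, map_smul]
    · show vec (p s * ((x * ρ) * p s')) = (s' : ℂ) • vec (p s * (x * p s'))
      rw [mul_assoc x, hρp, mul_smul_comm, mul_smul_comm, map_smul]
  have exp : ∀ x, Λ.meanMul V ρ (vec x) = ∑ s ∈ σ, ∑ s' ∈ σ, c s s' • vec (p s * x * p s') := by
    intro x
    have hx : x = ∑ s ∈ σ, ∑ s' ∈ σ, p s * x * p s' := by
      simp_rw [← Finset.mul_sum, ← Finset.sum_mul, hp1]
      simp
    conv_lhs => rw [hx]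
    simp only [map_sum]
    refine Finset.sum_congr rfl fun s hs => Finset.sum_congr rfl fun s' hs' => ?_
    have := congrArg (fun L : EuclideanSpace ℂ (ι × ι) →L[ℂ] EuclideanSpace ℂ (ι × ι) => L (vec x))
      (key s hs s' hs')
    rw [mul_assoc]
    exact this
  refine ⟨σ, p, c, hpM, exp, ?_⟩
  have h2 : ∀ s ∈ σ, ∑ s' ∈ σ, c s s' • vec (p s * 1 * p s') = vec (ρ * p s) := by
    intro s hs
    rw [Finset.sum_eq_single s]
    · rw [mul_one, hpp, if_pos rfl, hρp, map_smul, hcc]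
    · intro s' _ h
      rw [mul_one, hpp, if_neg (Ne.symm h), _root_.map_zero, smul_zero]
    · exact fun h => absurd hs h
  rw [exp, Finset.sum_congr rfl h2, ← map_sum, ← Finset.mul_sum, hp1, mul_one]

end MeanOfMultiplications

/-! ### The gradient norm does not depend on the Lindblad form -/

section Lindblad

variable {ι : Type*} [Fintype ι] [DecidableEq ι] {M : StarSubalgebra ℂ (Matrix ι ι ℂ)}
  {P : ℝ → M →ₗ[ℂ] M}

theorem IsLindbladForm.sum_symm {d : ℕ} {v : Fin d → Matrix ι ι ℂ} (hv : IsLindbladForm P v)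
    {R : Type*} [AddCommMonoid R] (f : Matrix ι ι ℂ → Matrix ι ι ℂ → R) :
    ∑ j, f (star (v j)) (v j) = ∑ j, f (v j) (star (v j)) := by
  obtain ⟨σ, hσ⟩ := hv.1
  rw [← Equiv.sum_comp σ (fun j => f (v j) (star (v j)))]
  exact Finset.sum_congr rfl fun j _ => by rw [hσ, star_star]

/-- Expanding the commutators in `2 Γ` gives the gradient product for the family and for its
adjoints, plus error terms in `v* v - v v*`. Symmetry of the family identifies the two products and
cancels the errors. -/
theorem IsLindbladForm.sum_star_partialD {d : ℕ} {v : Fin d → Matrix ι ι ℂ}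
    (hv : IsLindbladForm P v) (x y : M) :
    ∑ j, star (partialD (v j) (x : Matrix ι ι ℂ)) * partialD (v j) y = (carre P x y : M) := by
  have hcar : ((carre P x y : M) : Matrix ι ι ℂ)
      = (1 / 2 : ℂ) • (star (x : Matrix ι ι ℂ) * (generator P y : M)
        + star ((generator P x : M) : Matrix ι ι ℂ) * y - (generator P (star x * y) : M)) := rfl
  set T : Matrix ι ι ℂ → Matrix ι ι ℂ → Matrix ι ι ℂ := fun u w =>
    (star (x : Matrix ι ι ℂ) * u - u * star (x : Matrix ι ι ℂ)) * (w * y - y * w) with hT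
  have h1 : ∀ j, star (partialD (v j) (x : Matrix ι ι ℂ)) * partialD (v j) y
      = T (star (v j)) (v j) := fun j => by
    simp only [partialD, hT, star_sub, star_mul]
  have h2 : star (x : Matrix ι ι ℂ) * (generator P y : M)
      + star ((generator P x : M) : Matrix ι ι ℂ) * y - (generator P (star x * y) : M)
      = ∑ j, T (star (v j)) (v j) + ∑ j, T (v j) (star (v j))
        + (∑ j, star (x : Matrix ι ι ℂ) * (star (v j) * v j) * y
          - ∑ j, star (x : Matrix ι ι ℂ) * (v j * star (v j)) * y)
        + (∑ j, (v j * star (v j)) * star (x : Matrix ι ι ℂ) * y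
          - ∑ j, (star (v j) * v j) * star (x : Matrix ι ι ℂ) * y) := by
    rw [hv.2, hv.2, hv.2]
    simp only [star_sum, Finset.mul_sum, Finset.sum_mul, ← Finset.sum_add_distrib,
      ← Finset.sum_sub_distrib]
    refine Finset.sum_congr rfl fun j _ => ?_
    simp only [partialD, hT, star_sub, star_mul, star_star, MulMemClass.coe_mul,
      StarMemClass.coe_star]
    noncomm_ring
  rw [hcar, h2, hv.sum_symm T,
    hv.sum_symm (fun u w => star (x : Matrix ι ι ℂ) * (u * w) * (y : Matrix ι ι ℂ)),
    hv.sum_symm (fun u w => (u * w) * star (x : Matrix ι ι ℂ) * (y : Matrix ι ι ℂ)), sub_self,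
    sub_self, add_zero, add_zero, ← two_smul ℂ, smul_smul, Finset.sum_congr rfl fun j _ => h1 j,
    hv.sum_symm T]
  norm_num

/-- By the Leibniz rule `p (∂x) = ∂(p x) - (∂p) x`; the right side involves only the semigroup, not
the `v j`. -/
theorem IsLindbladForm.sum_star_partialD_mul {d : ℕ} {v : Fin d → Matrix ι ι ℂ}
    (hv : IsLindbladForm P v) (x p : M) :
    ∑ j, star (partialD (v j) (x : Matrix ι ι ℂ)) * p * partialD (v j) x
      = (carre P x (p * x) - carre P x p * x : M) := by
  have h : ∀ j, star (partialD (v j) (x : Matrix ι ι ℂ)) * p * partialD (v j) x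
      = star (partialD (v j) (x : Matrix ι ι ℂ)) * partialD (v j) ((p * x : M) : Matrix ι ι ℂ)
        - star (partialD (v j) (x : Matrix ι ι ℂ)) * partialD (v j) p * x := fun j => by
    simp only [partialD, MulMemClass.coe_mul]
    noncomm_ring
  rw [Finset.sum_congr rfl fun j _ => h j, Finset.sum_sub_distrib, ← Finset.sum_mul,
    hv.sum_star_partialD, hv.sum_star_partialD]
  rfl

variable {𝓗 : Type*} [NormedAddCommGroup 𝓗] [InnerProductSpace ℂ 𝓗] [CompleteSpace 𝓗]
  {Λ : OperatorMean 𝓗}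

/-- Inserting the spectral expansion of `ρ̂` leaves traces of `∑ (∂x)* p s (∂x)` against `p s'`.
Since `p s ∈ M`, these sums are expressed through the carré du champ. -/
theorem gradNormSq_eq_of_isLindbladForm (V : EuclideanSpace ℂ (ι × ι) →ₗᵢ[ℂ] 𝓗) {d d' : ℕ}
    {v : Fin d → Matrix ι ι ℂ} {w : Fin d' → Matrix ι ι ℂ} (hv : IsLindbladForm P v)
    (hw : IsLindbladForm P w) (x ρ : M) (hρ : (ρ : Matrix ι ι ℂ).PosSemidef) :
    gradNormSq Λ V v ρ x = gradNormSq Λ V w ρ x := by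
  obtain ⟨σ, p, c, hpM, hexp, -⟩ := Λ.exists_meanMul_expansion V M ρ.2 hρ
  have key : ∀ {n : ℕ} {u : Fin n → Matrix ι ι ℂ}, IsLindbladForm P u →
      ∑ j, inner ℂ (vec (partialD (u j) (x : Matrix ι ι ℂ)))
        (Λ.meanMul V ρ (vec (partialD (u j) (x : Matrix ι ι ℂ))))
      = ∑ s ∈ σ.attach, ∑ s' ∈ σ.attach, c s s' * (((carre P x (⟨p s, hpM s s.2⟩ * x)
        - carre P x ⟨p s, hpM s s.2⟩ * x : M) : Matrix ι ι ℂ) * p s').trace := by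
    intro n u hu
    have h1 : ∀ j, inner ℂ (vec (partialD (u j) (x : Matrix ι ι ℂ)))
        (Λ.meanMul V ρ (vec (partialD (u j) (x : Matrix ι ι ℂ))))
        = ∑ s ∈ σ.attach, ∑ s' ∈ σ.attach, c s s' *
          (star (partialD (u j) (x : Matrix ι ι ℂ)) * p s * partialD (u j) x * p s').trace := by
      intro j
      rw [hexp, ← Finset.sum_attach σ, inner_sum]
      refine Finset.sum_congr rfl fun s _ => ?_
      rw [← Finset.sum_attach σ, inner_sum]
      refine Finset.sum_congr rfl fun s' _ => ?_
      rw [inner_smul_right, inner_vec]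
      simp only [mul_assoc]
    rw [Finset.sum_congr rfl fun j _ => h1 j, Finset.sum_comm]
    refine Finset.sum_congr rfl fun s _ => ?_
    rw [Finset.sum_comm]
    refine Finset.sum_congr rfl fun s' _ => ?_
    rw [← hu.sum_star_partialD_mul, ← Finset.mul_sum, Finset.sum_mul, Matrix.trace_sum]
  have hg : ∀ {n : ℕ} (u : Fin n → Matrix ι ι ℂ), gradNormSq Λ V u ρ x
      = (Fintype.card ι : ℝ)⁻¹ * (∑ j, inner ℂ (vec (partialD (u j) (x : Matrix ι ι ℂ)))
        (Λ.meanMul V ρ (vec (partialD (u j) (x : Matrix ι ι ℂ))))).re := fun u => by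
    rw [Complex.re_sum]
    rfl
  rw [hg, hg, key hv, key hw]

end Lindblad

/-! ### Operator means and Hadamard products -/

section Hadamard

variable {κ : Type*} [Fintype κ] [DecidableEq κ]

/-- The matrix of an operator on a Euclidean space. -/
noncomputable def opMatrix (A : EuclideanSpace ℂ κ →L[ℂ] EuclideanSpace ℂ κ) : Matrix κ κ ℂ :=
  (Matrix.toEuclideanCLM (𝕜 := ℂ) (n := κ)).symm A

theorem opMatrix_toEuclideanCLM (X : Matrix κ κ ℂ) :
    opMatrix (Matrix.toEuclideanCLM (𝕜 := ℂ) X) = X :=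
  StarAlgEquiv.symm_apply_apply _ _

theorem toEuclideanCLM_opMatrix (A : EuclideanSpace ℂ κ →L[ℂ] EuclideanSpace ℂ κ) :
    Matrix.toEuclideanCLM (𝕜 := ℂ) (opMatrix A) = A :=
  StarAlgEquiv.apply_symm_apply _ _

theorem inner_apply_eq_opMatrix (A : EuclideanSpace ℂ κ →L[ℂ] EuclideanSpace ℂ κ)
    (f g : EuclideanSpace ℂ κ) :
    inner ℂ f (A g) = ∑ p, ∑ q, star (f p) * opMatrix A p q * g q := by
  conv_lhs => rw [← toEuclideanCLM_opMatrix A]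
  simp only [PiLp.inner_apply, RCLike.inner_apply, Matrix.ofLp_toEuclideanCLM, Matrix.mulVec,
    dotProduct]
  refine Finset.sum_congr rfl fun p _ => ?_
  rw [Finset.sum_mul]
  refine Finset.sum_congr rfl fun q _ => ?_
  simp
  ring

theorem posSemidef_opMatrix {A : EuclideanSpace ℂ κ →L[ℂ] EuclideanSpace ℂ κ} (hA : 0 ≤ A) :
    (opMatrix A).PosSemidef := by
  obtain ⟨S, rfl⟩ := CStarAlgebra.nonneg_iff_eq_star_mul_self.1 hA
  rw [← toEuclideanCLM_opMatrix S, ← map_star, ← map_mul, opMatrix_toEuclideanCLM]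
  exact Matrix.posSemidef_conjTranspose_mul_self _

variable {𝓗 : Type*} [NormedAddCommGroup 𝓗] [InnerProductSpace ℂ 𝓗] [CompleteSpace 𝓗]
  {Λ : OperatorMean 𝓗}

/-- Factor `K = C* C` and let `D n` be the diagonal matrix of the `n`-th row of `C`. Then `∑ (D n)*
Z (D n)` is the Hadamard product of `Z` with `K`, and the unit diagonal of `K` is the normalization
`∑ (D n)* (D n) = 1`. -/
theorem OperatorMean.hadamard_compress_le (h𝓗 : ¬ FiniteDimensional ℂ 𝓗)
    {V : EuclideanSpace ℂ κ →L[ℂ] 𝓗} (hV : V.adjoint ∘L V = 1) {K : Matrix κ κ ℂ}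
    (hK : K.PosSemidef) (hK1 : ∀ p, K p p = 1)
    {A B : EuclideanSpace ℂ κ →L[ℂ] EuclideanSpace ℂ κ} (hA : 0 ≤ A) (hB : 0 ≤ B) :
    Matrix.toEuclideanCLM (𝕜 := ℂ) ((opMatrix (Λ.compress V A B)).hadamard K)
      ≤ Λ.compress V (Matrix.toEuclideanCLM (𝕜 := ℂ) ((opMatrix A).hadamard K))
        (Matrix.toEuclideanCLM (𝕜 := ℂ) ((opMatrix B).hadamard K)) := by
  obtain ⟨C, rfl⟩ := CStarAlgebra.nonneg_iff_eq_star_mul_self.1 hK.nonneg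
  set D : Fin (Fintype.card κ) → EuclideanSpace ℂ κ →L[ℂ] EuclideanSpace ℂ κ := fun n =>
    Matrix.toEuclideanCLM (𝕜 := ℂ) (Matrix.diagonal (C ((Fintype.equivFin κ).symm n))) with hDdef
  have hsum : ∀ Z : EuclideanSpace ℂ κ →L[ℂ] EuclideanSpace ℂ κ, ∑ n, star (D n) * Z * D n
      = Matrix.toEuclideanCLM (𝕜 := ℂ) ((opMatrix Z).hadamard (star C * C)) := by
    intro Z
    rw [(Fintype.equivFin κ).symm.sum_comp (fun n => star (Matrix.toEuclideanCLM (𝕜 := ℂ)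
      (Matrix.diagonal (C n))) * Z * Matrix.toEuclideanCLM (𝕜 := ℂ) (Matrix.diagonal (C n)))]
    conv_lhs => rw [← toEuclideanCLM_opMatrix Z]
    simp only [← map_star, ← map_mul, ← map_sum]
    congr 1
    ext p q
    rw [Matrix.sum_apply, Matrix.hadamard_apply, Matrix.mul_apply, Finset.mul_sum]
    refine Finset.sum_congr rfl fun n _ => ?_
    rw [Matrix.mul_diagonal, Matrix.star_eq_conjTranspose, Matrix.diagonal_conjTranspose,
      Matrix.diagonal_mul, Matrix.star_apply, Pi.star_apply]
    ring
  have hD : ∑ n, star (D n) * D n = 1 := by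
    have h1 := hsum 1
    simp only [mul_one] at h1
    rw [h1, ← _root_.map_one (Matrix.toEuclideanCLM (𝕜 := ℂ) (n := κ)), opMatrix_toEuclideanCLM]
    congr 1
    ext p q
    by_cases h : p = q
    · subst h
      simp [hK1]
    · simp [h]
  have h := sum_compress_le (Λ := Λ) h𝓗 hV D hD hA hB
  rwa [hsum, hsum, hsum] at h

end Hadamard

/-! ### The gradient estimate for Schur multipliers -/

section GradientEstimate

variable {ι : Type*} [Fintype ι] [DecidableEq ι]

theorem opMatrix_leftMul (ρ : Matrix ι ι ℂ) :
    opMatrix (leftMul ρ) = Matrix.of fun p q => if p.2 = q.2 then ρ p.1 q.1 else 0 := by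
  rw [← opMatrix_toEuclideanCLM (Matrix.of _)]
  congr 1
  refine clm_ext_vec fun x => ?_
  rw [leftMul_vec]
  ext p
  simp [vec, Matrix.mulVec, dotProduct, Fintype.sum_prod_type]
  exact Matrix.mul_apply

theorem opMatrix_rightMul (ρ : Matrix ι ι ℂ) :
    opMatrix (rightMul ρ) = Matrix.of fun p q => if p.1 = q.1 then ρ q.2 p.2 else 0 := by
  rw [← opMatrix_toEuclideanCLM (Matrix.of _)]
  congr 1
  refine clm_ext_vec fun x => ?_
  rw [rightMul_vec]
  ext p
  simp [vec, Matrix.mulVec, dotProduct, Fintype.sum_prod_type_right, mul_comm (ρ _ _)]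
  exact Matrix.mul_apply

variable {M : StarSubalgebra ℂ (Matrix ι ι ℂ)} {r : ℕ} {b : ι → Fin r → ℝ}
  {hMb : ∀ (t : ℝ), ∀ x ∈ M, (Matrix.of fun i j => Complex.exp (-t * sqDist b i j) * x i j) ∈ M}

/-- The diagonal matrices of the coordinates of the points `b i`. -/
noncomputable def coordMatrix (b : ι → Fin r → ℝ) (k : Fin r) : Matrix ι ι ℂ :=
  Matrix.diagonal fun i => (b i k : ℂ)

theorem partialD_coordMatrix (b : ι → Fin r → ℝ) (k : Fin r) (x : Matrix ι ι ℂ) (i j : ι) :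
    partialD (coordMatrix b k) x i j = ((b i - b j) k : ℝ) * x i j := by
  simp only [partialD, coordMatrix, Matrix.sub_apply, Matrix.diagonal_mul, Matrix.mul_diagonal,
    Pi.sub_apply]
  push_cast
  ring

theorem star_coordMatrix (b : ι → Fin r → ℝ) (k : Fin r) :
    star (coordMatrix b k) = coordMatrix b k := by
  rw [coordMatrix, Matrix.star_eq_conjTranspose, Matrix.diagonal_conjTranspose]
  congr 1
  funext i
  simp

theorem isLindbladForm_coordMatrix : IsLindbladForm (schurOn (sqDist b) M hMb) (coordMatrix b) := by
  refine ⟨⟨1, fun k => (star_coordMatrix b k).symm⟩, fun x => ?_⟩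
  ext i j
  simp only [generator_schurOn, Matrix.sum_apply, star_coordMatrix, partialD_coordMatrix,
    Matrix.of_apply]
  rw [show sqDist b i j = ∑ k, (((b i - b j) k : ℝ) : ℂ) * ((b i - b j) k : ℝ) by
    simp [sqDist, dotProduct], Finset.sum_mul]
  exact Finset.sum_congr rfl fun k _ => mul_assoc _ _ _

theorem gaussKernel_self {κ : Type*} (c : κ → Fin r → ℝ) (t : ℝ) (p : κ) : gaussKernel c t p p = 1 := by
  simp [gaussKernel]

/-- The differences of the points `b i`. -/
def pairDiff (b : ι → Fin r → ℝ) (p : ι × ι) : Fin r → ℝ := b p.1 - b p.2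

/-- Left multiplication only couples pairs `(i, j)` and `(k, j)`, where the differences `b i - b j`
and `b k - b j` are `b i - b k` apart. The mirror statement for right multiplication uses the same
kernel on pairs, as a single Hadamard bound for the mean requires. -/
theorem leftMul_hadamard_gaussKernel (t : ℝ) (ρ : M) :
    Matrix.toEuclideanCLM (𝕜 := ℂ)
      ((opMatrix (leftMul (ρ : Matrix ι ι ℂ))).hadamard (gaussKernel (pairDiff b) t))
      = leftMul (schurOn (sqDist b) M hMb t ρ : Matrix ι ι ℂ) := by
  rw [← toEuclideanCLM_opMatrix (leftMul (schurOn (sqDist b) M hMb t ρ : Matrix ι ι ℂ))]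
  congr 1
  rw [opMatrix_leftMul, opMatrix_leftMul]
  ext ⟨i, j⟩ ⟨k, l⟩
  by_cases h : j = l
  · subst h
    simp [schurOn_sqDist_apply, gaussKernel, pairDiff, mul_comm]
  · simp [h]

theorem rightMul_hadamard_gaussKernel (t : ℝ) (ρ : M) :
    Matrix.toEuclideanCLM (𝕜 := ℂ)
      ((opMatrix (rightMul (ρ : Matrix ι ι ℂ))).hadamard (gaussKernel (pairDiff b) t))
      = rightMul (schurOn (sqDist b) M hMb t ρ : Matrix ι ι ℂ) := by
  rw [← toEuclideanCLM_opMatrix (rightMul (schurOn (sqDist b) M hMb t ρ : Matrix ι ι ℂ))]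
  congr 1
  rw [opMatrix_rightMul, opMatrix_rightMul]
  ext ⟨i, j⟩ ⟨k, l⟩
  by_cases h : i = k
  · subst h
    rw [Matrix.hadamard_apply]
    simp only [Matrix.of_apply, if_true, schurOn_sqDist_apply]
    rw [mul_comm, gaussKernel_comm b t l j]
    congr 1
    simp only [gaussKernel, pairDiff, Matrix.of_apply, sub_sub_sub_cancel_left]
    rw [← neg_sub (b l) (b j), neg_dotProduct_neg]
  · simp [h]

variable {𝓗 : Type*} [NormedAddCommGroup 𝓗] [InnerProductSpace ℂ 𝓗] [CompleteSpace 𝓗]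
  {Λ : OperatorMean 𝓗}

/-- The sesquilinear form of a matrix. -/
noncomputable def quadForm {κ : Type*} [Fintype κ] (X : Matrix κ κ ℂ) (f : κ → ℂ) : ℂ :=
  ∑ p, ∑ q, star (f p) * X p q * f q

theorem quadForm_nonneg {κ : Type*} [Fintype κ] {X : Matrix κ κ ℂ} (hX : X.PosSemidef) (f : κ → ℂ) :
    0 ≤ (quadForm X f).re := by
  have h := hX.dotProduct_mulVec_nonneg f
  have h2 : star f ⬝ᵥ X.mulVec f = quadForm X f := by
    simp only [dotProduct, Matrix.mulVec, quadForm, Finset.mul_sum, Pi.star_apply, mul_assoc]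
  rw [h2] at h
  exact (Complex.le_def.1 h).1

theorem sum_quadForm {κ : Type*} [Fintype κ] (X : Matrix κ κ ℂ) (c : κ → Fin r → ℝ) (f : κ → ℂ) :
    ∑ k, quadForm X (fun p => (c p k : ℝ) * f p)
      = quadForm (Matrix.of fun p q => X p q * (c p ⬝ᵥ c q : ℝ)) f := by
  simp only [quadForm]
  rw [Finset.sum_comm]
  refine Finset.sum_congr rfl fun p _ => ?_
  rw [Finset.sum_comm]
  refine Finset.sum_congr rfl fun q _ => ?_
  simp only [dotProduct, Complex.ofReal_sum, Matrix.of_apply, Finset.mul_sum, Finset.sum_mul]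
  refine Finset.sum_congr rfl fun k _ => ?_
  simp
  ring

theorem gradNormSq_coordMatrix (V : EuclideanSpace ℂ (ι × ι) →ₗᵢ[ℂ] 𝓗) (ρ x : Matrix ι ι ℂ) :
    gradNormSq Λ V (coordMatrix b) ρ x = (Fintype.card ι : ℝ)⁻¹ *
      ∑ k, (quadForm (opMatrix (Λ.meanMul V ρ)) fun p => (pairDiff b p k : ℝ) * x p.1 p.2).re := by
  show (Fintype.card ι : ℝ)⁻¹ * ∑ k, (inner ℂ (vec (partialD (coordMatrix b k) x))
    (Λ.meanMul V ρ (vec (partialD (coordMatrix b k) x)))).re = _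
  congr 1
  refine Finset.sum_congr rfl fun k _ => congrArg Complex.re ?_
  rw [inner_apply_eq_opMatrix, quadForm]
  have h : ∀ p : ι × ι, (vec (partialD (coordMatrix b k) x)) p
      = (pairDiff b p k : ℝ) * x p.1 p.2 := fun p => partialD_coordMatrix b k x p.1 p.2
  simp only [h]

theorem quadForm_hadamard_le (h𝓗 : ¬ FiniteDimensional ℂ 𝓗)
    (V : EuclideanSpace ℂ (ι × ι) →ₗᵢ[ℂ] 𝓗) {t : ℝ} (ht : 0 ≤ t) (ρ : M)
    (hρ : (ρ : Matrix ι ι ℂ).PosSemidef) (f : ι × ι → ℂ) :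
    (quadForm ((opMatrix (Λ.meanMul V ρ)).hadamard (gaussKernel (pairDiff b) t)) f).re
      ≤ (quadForm (opMatrix (Λ.meanMul V (schurOn (sqDist b) M hMb t ρ))) f).re := by
  have h := OperatorMean.hadamard_compress_le (Λ := Λ) h𝓗 (adjoint_comp_self_of_isometry V)
    (posSemidef_gaussKernel (pairDiff b) ht) (gaussKernel_self _ t) (leftMul_nonneg hρ)
    (rightMul_nonneg hρ)
  rw [leftMul_hadamard_gaussKernel (hMb := hMb), rightMul_hadamard_gaussKernel (hMb := hMb),
    ContinuousLinearMap.le_def] at h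
  have h1 := h.re_inner_nonneg_right (WithLp.toLp 2 f)
  rw [sub_apply, inner_sub_right, inner_apply_eq_opMatrix,
    inner_apply_eq_opMatrix, opMatrix_toEuclideanCLM, map_sub] at h1
  exact sub_nonneg.1 h1

theorem sq_norm_inner_le {E : Type*} [NormedAddCommGroup E] [InnerProductSpace ℂ E] [CompleteSpace E]
    {A : E →L[ℂ] E} (hA : 0 ≤ A) (x y : E) :
    ‖inner ℂ x (A y)‖ ^ 2 ≤ (inner ℂ x (A x)).re * (inner ℂ y (A y)).re := by
  obtain ⟨S, rfl⟩ := CStarAlgebra.nonneg_iff_eq_star_mul_self.1 hA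
  have h : ∀ u v : E, inner ℂ u ((star S * S) v) = inner ℂ (S u) (S v) := fun u v =>
    ContinuousLinearMap.adjoint_inner_right S u (S v)
  have h2 : ∀ u : E, (inner ℂ (S u) (S u)).re = ‖S u‖ ^ 2 := fun u =>
    inner_self_eq_norm_sq (𝕜 := ℂ) (S u)
  rw [h, h, h, h2, h2, ← mul_pow]
  gcongr
  exact norm_inner_le_norm _ _

theorem GE_schurOn (h𝓗 : ¬ FiniteDimensional ℂ 𝓗) (Λ : OperatorMean 𝓗) {N : ℝ} (hN : 0 < N)
    (hr : (r : ℝ) ≤ N) : GE Λ (schurOn (sqDist b) M hMb) 0 N := by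
  refine ⟨isSymmetricQMS_schurOn, ⟨r, _, isLindbladForm_coordMatrix⟩, ?_⟩
  intro d v hv V t ht a ρ hρ hτ
  have hρ0 := hρ.posSemidef
  have hPρ0 : (schurOn (sqDist b) M hMb t ρ : Matrix ι ι ℂ).PosSemidef := by
    convert posSemidef_mul_entries (posSemidef_gaussKernel b ht) hρ0 using 1
    ext i j
    exact schurOn_sqDist_apply t ρ i j
  rw [gradNormSq_eq_of_isLindbladForm V hv isLindbladForm_coordMatrix _ _ hρ0,
    gradNormSq_eq_of_isLindbladForm V hv isLindbladForm_coordMatrix _ _ hPρ0,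
    gradNormSq_coordMatrix, gradNormSq_coordMatrix]
  set c := pairDiff b
  set R := opMatrix (Λ.meanMul V ρ) with hR
  have hR0 : R.PosSemidef := posSemidef_opMatrix (OperatorMean.meanMul_nonneg V hρ0)
  set e : ι × ι → ℝ := fun p => Real.exp (-t * (c p ⬝ᵥ c p)) with he
  set α : ι × ι → ℂ := fun p => (a : Matrix ι ι ℂ) p.1 p.2 with hα
  set z : ι × ι → ℂ := fun p => ((e p * (c p ⬝ᵥ c p) : ℝ) : ℂ) * α p with hz
  have hPa : ∀ p : ι × ι, (schurOn (sqDist b) M hMb t a : Matrix ι ι ℂ) p.1 p.2 = e p * α p :=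
    fun p => schurOn_sqDist_apply t a p.1 p.2
  have hmid : ∀ k, (quadForm (R.hadamard (gaussKernel c t)) fun p => (c p k : ℝ) * α p).re
      ≤ (quadForm (opMatrix (Λ.meanMul V (schurOn (sqDist b) M hMb t ρ)))
        fun p => (c p k : ℝ) * α p).re := fun k => quadForm_hadamard_le h𝓗 V ht ρ hρ0 _
  -- The definition of `dimKernel`, solved for its first term and weighted by `R`. The three terms
  -- are the gradient of `P t a`, the dimensional gain, and a nonnegative remainder; `z` is the
  -- family of entries of `L P t a`.
  have hid : ∑ k, quadForm (R.hadamard (gaussKernel c t)) (fun p => (c p k : ℝ) * α p)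
      = ∑ k, quadForm R (fun p => (c p k : ℝ) * (e p * α p))
        + ((2 * t / N : ℝ) : ℂ) * quadForm R z
        + quadForm (Matrix.of fun p q => R p q * dimKernel c t N p q) α := by
    rw [sum_quadForm, sum_quadForm R c fun p => e p * α p]
    simp only [quadForm]
    rw [Finset.mul_sum, ← Finset.sum_add_distrib, ← Finset.sum_add_distrib]
    refine Finset.sum_congr rfl fun p _ => ?_
    rw [Finset.mul_sum, ← Finset.sum_add_distrib, ← Finset.sum_add_distrib]
    refine Finset.sum_congr rfl fun q _ => ?_
    simp only [hz, he, gaussKernel, dimKernel, Matrix.of_apply, Matrix.hadamard_apply,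
      Complex.ofReal_sub, Complex.ofReal_mul, star_mul', Complex.star_def, Complex.conj_ofReal]
    ring
  have hker : 0 ≤ (quadForm (Matrix.of fun p q => R p q * dimKernel c t N p q) α).re :=
    quadForm_nonneg (posSemidef_mul_entries hR0 (posSemidef_dimKernel c ht hN hr)) α
  have hidre := congrArg Complex.re hid
  rw [Complex.add_re, Complex.add_re, Complex.re_ofReal_mul, Complex.re_sum, Complex.re_sum] at hidre
  have hsum := Finset.sum_le_sum fun k (_ : k ∈ Finset.univ) => hmid k
  obtain ⟨-, -, -, -, -, hone⟩ := Λ.exists_meanMul_expansion V M ρ.2 hρ0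
  set Z : Matrix ι ι ℂ := Matrix.of fun i j => z (i, j) with hZ
  -- Since `ρ̂ 1 = ρ`, the second factor on the right is `tr ρ`, equal to the size of `ι` because
  -- `τ(ρ) = 1`.
  have hcs := sq_norm_inner_le (OperatorMean.meanMul_nonneg (Λ := Λ) V hρ0) (vec Z) (vec 1)
  have hZZ : inner ℂ (vec Z) (Λ.meanMul V ρ (vec Z)) = quadForm R z :=
    inner_apply_eq_opMatrix _ _ _
  -- On an empty index set `τ` vanishes, contradicting `τ(ρ) = 1`.
  have hcard : (Fintype.card ι : ℂ) ≠ 0 := by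
    intro h
    simp [tau, h] at hτ
  have htr : (ρ : Matrix ι ι ℂ).trace = Fintype.card ι := by
    rw [tau, inv_mul_eq_one₀ hcard] at hτ
    exact hτ.symm
  have hcard' : (0 : ℝ) < Fintype.card ι := by
    rw [Nat.cast_pos, Nat.pos_iff_ne_zero]
    exact_mod_cast hcard
  rw [hone, hZZ, inner_vec 1, star_one, one_mul, htr, Complex.natCast_re] at hcs
  have htau : tau (star (a : Matrix ι ι ℂ) * (generator (schurOn (sqDist b) M hMb)
      (schurOn (sqDist b) M hMb t ρ) : Matrix ι ι ℂ))
      = ((Fintype.card ι : ℝ)⁻¹ : ℝ) * inner ℂ (vec Z) (vec (ρ : Matrix ι ι ℂ)) := by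
    rw [tau, inner_vec]
    push_cast
    congr 1
    simp only [Matrix.trace, Matrix.diag, Matrix.mul_apply, Matrix.star_apply, generator_schurOn,
      Matrix.of_apply, schurOn_sqDist_apply, hZ]
    refine Finset.sum_congr rfl fun j _ => Finset.sum_congr rfl fun i _ => ?_
    simp only [hz, he, hα, gaussKernel, sqDist, Matrix.of_apply, star_mul', Complex.star_def,
      Complex.conj_ofReal, Complex.ofReal_mul]
    rw [show c (i, j) = b i - b j from rfl]
    ring
  rw [htau, norm_mul, Complex.norm_real, Real.norm_of_nonneg (by positivity), mul_pow]
  simp only [hPa, dimCoeff, if_true, mul_zero, zero_mul, Real.exp_zero, one_mul]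
  set n : ℝ := (Fintype.card ι : ℝ)
  have h1 : n⁻¹ * ((n⁻¹) * ‖inner ℂ (vec Z) (vec (ρ : Matrix ι ι ℂ))‖ ^ 2) ≤ n⁻¹ * (quadForm R z).re := by
    gcongr
    rw [inv_mul_le_iff₀ hcard', mul_comm]
    exact hcs
  have h2 : 2 * t / N * (n⁻¹ ^ 2 * ‖inner ℂ (vec Z) (vec (ρ : Matrix ι ι ℂ))‖ ^ 2)
      ≤ n⁻¹ * (2 * t / N * (quadForm R z).re) := by
    have h3 : 0 ≤ 2 * t / N := by positivity
    calc _ = 2 * t / N * (n⁻¹ * ((n⁻¹) * ‖inner ℂ (vec Z) (vec (ρ : Matrix ι ι ℂ))‖ ^ 2)) := by ring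
      _ ≤ 2 * t / N * (n⁻¹ * (quadForm R z).re) := by gcongr
      _ = _ := by ring
  rw [le_sub_iff_add_le]
  refine (add_le_add_right h2 _).trans ?_
  rw [← mul_add]
  gcongr
  linarith

theorem CGE_schurOn (h𝓗 : ¬ FiniteDimensional ℂ 𝓗) (Λ : OperatorMean 𝓗) {N : ℝ} (hN : 0 < N)
    (hr : (r : ℝ) ≤ N) : CGE Λ (schurOn (sqDist b) M hMb) 0 N := fun m _ => by
  rw [show (fun t => amplifyMap m (schurOn (sqDist b) M hMb t))
    = schurOn (sqDist fun p : Fin m × ι => b p.2) (amplify m M) (amplify_sqDist_mem m hMb) from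
    funext fun t => amplifyMap_schurOn m t]
  exact GE_schurOn h𝓗 Λ hN hr

end GradientEstimate

/-! ### Conditionally negative definite symbols -/

section Symbols

variable {ι : Type*} [Fintype ι] [DecidableEq ι] {a : Matrix ι ι ℂ}

/-- Differentiating at `0` removes the `2πi` ambiguity of a single exponential. -/
theorem eq_of_exp_eq {z w : ℂ} (h : ∀ t : ℝ, 0 < t → Complex.exp (-t * z) = Complex.exp (-t * w)) :
    z = w := by
  have h1 := tendsto_expQuotient z 1
  have h2 := tendsto_expQuotient w 1
  simp only [mul_one] at h1 h2
  refine tendsto_nhds_unique (h1.congr' ?_) h2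
  filter_upwards [self_mem_nhdsWithin] with t ht
  rw [h t ht]

/-- A Schur multiplier sends the positive all-ones matrix to its own symbol. -/
theorem posSemidef_exp_of_isSymmetricQMS (h : IsSymmetricQMS (schurSemigroup a)) {t : ℝ}
    (ht : 0 ≤ t) : (Matrix.of fun i j => Complex.exp (-t * a i j)).PosSemidef := by
  have h1 : (Matrix.of fun _ _ : Fin 1 × ι => (1 : ℂ)).PosSemidef := by
    convert Matrix.posSemidef_vecMulVec_self_star (fun _ : Fin 1 × ι => (1 : ℂ)) using 1
    ext p q
    simp [Matrix.vecMulVec]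
  have h2 := h.completelyPositive t ht 1 ⟨Matrix.of fun _ _ => 1, fun _ _ => trivial⟩
    (matrix_nonneg_iff.2 h1)
  have h3 := (matrix_nonneg_iff.1 h2).submatrix fun i : ι => ((0 : Fin 1), i)
  have h4 : ((amplifyMap 1 (schurSemigroup a t)) ⟨Matrix.of fun _ _ => 1, fun _ _ => trivial⟩ :
      Matrix (Fin 1 × ι) (Fin 1 × ι) ℂ).submatrix (fun i : ι => ((0 : Fin 1), i))
      (fun i : ι => ((0 : Fin 1), i)) = Matrix.of fun i j => Complex.exp (-t * a i j) * 1 := rfl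
  rw [h4] at h3
  simpa only [mul_one] using h3

theorem isCNDSymbol_of_isSymmetricQMS (h : IsSymmetricQMS (schurSemigroup a)) : IsCNDSymbol a := by
  have hdiag : ∀ i, a i i = 0 := by
    intro i
    refine eq_of_exp_eq fun t ht => ?_
    have h1 := congrArg (fun x : (⊤ : StarSubalgebra ℂ (Matrix ι ι ℂ)) => (x : Matrix ι ι ℂ) i i)
      (h.unital t ht.le)
    have h2 : Complex.exp (-t * a i i) * (1 : Matrix ι ι ℂ) i i = (1 : Matrix ι ι ℂ) i i := h1
    simpa using h2
  have hsymm : ∀ i j, a i j = a j i := by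
    intro i j
    refine eq_of_exp_eq fun t ht => ?_
    have h1 := h.symmetric t ht.le ⟨Matrix.single i j 1, trivial⟩ ⟨Matrix.single j i 1, trivial⟩
    have h2 : ∀ k l : ι, (schurSemigroup a t ⟨Matrix.single k l 1, trivial⟩ : Matrix ι ι ℂ)
        = Matrix.single k l (Complex.exp (-t * a k l)) := by
      intro k l
      ext p q
      show Complex.exp (-t * a p q) * Matrix.single k l 1 p q = _
      simp only [Matrix.single_apply]
      split_ifs with hpq
      · rw [hpq.1, hpq.2, mul_one]
      · rw [mul_zero]
    rw [h2, h2] at h1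
    have hc : (Fintype.card ι : ℂ) ≠ 0 := by
      have : Nonempty ι := ⟨i⟩
      exact_mod_cast Fintype.card_ne_zero
    simpa [tau, hc] using h1
  have hcnd : ∀ α : ι → ℂ, ∑ i, α i = 0 → ∑ i, ∑ j, star (α i) * α j * a i j ≤ 0 := by
    intro α hα
    -- When `∑ α i = 0` the constant part of the quotient drops out, and minus a positive form
    -- divided by `t` remains.
    have hlim : Tendsto (fun t : ℝ => ∑ i, ∑ j, (t : ℂ)⁻¹ * (star (α i) * α j
        - Complex.exp (-t * a i j) * (star (α i) * α j))) (𝓝[>] (0 : ℝ))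
        (𝓝 (∑ i, ∑ j, a i j * (star (α i) * α j))) :=
      tendsto_finsetSum _ fun i _ => tendsto_finsetSum _ fun j _ => tendsto_expQuotient _ _
    simp only [mul_comm (a _ _)] at hlim
    refine le_of_tendsto hlim ?_
    filter_upwards [self_mem_nhdsWithin] with t ht
    have h0 : ∑ i, ∑ j, star (α i) * α j = 0 := by
      simp [← Finset.mul_sum, hα]
    have h1 := (posSemidef_exp_of_isSymmetricQMS h (le_of_lt ht)).dotProduct_mulVec_nonneg α
    have h2 : ∑ i, ∑ j, (t : ℂ)⁻¹ * (star (α i) * α j - Complex.exp (-t * a i j) * (star (α i) * α j))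
        = -((t : ℂ)⁻¹ * (star α ⬝ᵥ (Matrix.of fun i j => Complex.exp (-t * a i j)).mulVec α)) := by
      have h3 : ∑ i, ∑ j, (t : ℂ)⁻¹ * (star (α i) * α j) = 0 := by
        rw [← mul_zero (t : ℂ)⁻¹, ← h0]
        simp only [Finset.mul_sum]
      simp only [mul_sub, Finset.sum_sub_distrib]
      rw [h3, zero_sub]
      simp only [dotProduct, Matrix.mulVec, Finset.mul_sum, Pi.star_apply, Matrix.of_apply]
      congr 1
      exact Finset.sum_congr rfl fun i _ => Finset.sum_congr rfl fun j _ => by ring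
    rw [h2, neg_nonpos]
    refine mul_nonneg ?_ h1
    rw [← Complex.ofReal_inv]
    exact_mod_cast (inv_pos.2 ht).le
  refine ⟨hdiag, hsymm, fun i j => ?_, hcnd⟩
  rcases eq_or_ne i j with rfl | hij
  · rw [hdiag]
  · have h1 := hcnd (Pi.single i 1 - Pi.single j 1) (by simp)
    have h2 : ∑ k, ∑ l, star ((Pi.single i 1 - Pi.single j 1 : ι → ℂ) k)
        * (Pi.single i 1 - Pi.single j 1 : ι → ℂ) l * a k l
        = a i i - a j i - (a i j - a j j) := by
      have h3 : ∀ k, star ((Pi.single i 1 - Pi.single j 1 : ι → ℂ) k)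
          = (if k = i then 1 else 0) - (if k = j then 1 else 0) := by
        intro k
        simp only [Pi.sub_apply, Pi.single_apply, star_sub]
        split_ifs <;> simp
      simp only [h3]
      simp only [Pi.sub_apply, Pi.single_apply, sub_mul, mul_sub, ite_mul, mul_ite, zero_mul,
        one_mul, mul_zero, mul_one, Finset.sum_sub_distrib, Finset.sum_ite_eq', Finset.mem_univ,
        if_true]
    rw [h2, hdiag, hdiag, hsymm j i] at h1
    have h3 : 0 ≤ (2 : ℂ) * a i j := by
      have := neg_nonneg.2 h1
      convert this using 1
      ring
    have h4 : (0 : ℂ) ≤ 2⁻¹ := by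
      rw [show (2 : ℂ)⁻¹ = ((2⁻¹ : ℝ) : ℂ) by simp]
      exact_mod_cast (by norm_num : (0 : ℝ) ≤ 2⁻¹)
    simpa using mul_nonneg h4 h3

theorem isCNDSymbol_sqDist {r : ℕ} (b : ι → Fin r → ℝ) : IsCNDSymbol (sqDist b) :=
  isCNDSymbol_of_isSymmetricQMS isSymmetricQMS_schurOn

/-- Schoenberg's embedding theorem. -/
theorem IsCNDSymbol.exists_eq_sqDist (ha : IsCNDSymbol a) (i₀ : ι) :
    ∃ b : ι → Fin (Fintype.card ι - 1) → ℝ, a = sqDist b := by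
  have hre : ∀ i j, a i j = ((a i j).re : ℂ) := fun i j =>
    Complex.eq_re_of_ofReal_le (r := 0) (by simpa using ha.nonneg i j)
  set s : ι → ι → ℝ := fun i j => (a i j).re with hs
  have hsymm : ∀ i j, s i j = s j i := fun i j => by rw [hs]; simp only [ha.symm i j]
  have hdiag : ∀ i, s i i = 0 := fun i => by simp [hs, ha.diag]
  set κ := {i : ι // i ≠ i₀}
  -- The inner products forced by polarization once `i₀` sits at the origin; dropping `i₀` saves one
  -- dimension.
  set Gr : Matrix κ κ ℝ := Matrix.of fun i j => (s i i₀ + s i₀ j - s i j) / 2 with hGr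
  have hsub : ∀ f : ι → ℝ, ∑ i, f i = ∑ i : κ, f i + f i₀ := by
    intro f
    rw [← Finset.sum_subtype (Finset.univ.erase i₀) (by simp) f, Finset.sum_erase_add _ _ (Finset.mem_univ _)]
  have hPSD : Gr.PosSemidef := by
    refine Matrix.PosSemidef.of_dotProduct_mulVec_nonneg ?_ fun x => ?_
    · ext i j
      simp only [hGr, Matrix.conjTranspose_apply, Matrix.of_apply, star_trivial]
      rw [hsymm j i, hsymm j i₀, hsymm i₀ i]
      ring
    -- The weight at `i₀` makes the total zero, so conditional negativity applies; its form is `-2`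
    -- times that of `Gr`.
    · set α : ι → ℝ := fun i => if h : i = i₀ then -∑ k, x k else x ⟨i, h⟩ with hα
      have hαs : ∀ i : κ, α i = x i := fun i => by simp [hα, i.2]
      have hα0 : α i₀ = -∑ k, x k := by simp [hα]
      have h1 := ha.cnd (fun i => (α i : ℂ)) (by
        rw [← Complex.ofReal_sum, hsub]
        simp [hαs, hα0])
      have h2 : ∑ i, ∑ j, star ((α i : ℂ)) * (α j : ℂ) * a i j
          = ((∑ i, ∑ j, α i * α j * s i j : ℝ) : ℂ) := by
        push_cast
        refine Finset.sum_congr rfl fun i _ => Finset.sum_congr rfl fun j _ => ?_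
        rw [hre i j]
        simp [hs]
      rw [h2] at h1
      have h3 : ∑ i, ∑ j, α i * α j * s i j ≤ 0 := by exact_mod_cast h1
      have h4 : ∑ i, ∑ j, α i * α j * s i j = -2 * (star x ⬝ᵥ Gr.mulVec x) := by
        simp only [hsub, hαs, hα0, hdiag, Finset.sum_add_distrib, dotProduct, Matrix.mulVec, hGr,
          Matrix.of_apply, Pi.star_apply, star_trivial, mul_zero, add_zero]
        simp only [Finset.mul_sum, neg_mul, mul_neg, Finset.sum_neg_distrib, Finset.sum_mul]
        rw [← sub_eq_add_neg, ← sub_eq_add_neg]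
        have e1 : ∑ i : κ, ∑ k : κ, x i * x k * s i i₀ = ∑ i : κ, ∑ j : κ, x i * x j * s i i₀ := rfl
        have e2 : ∑ j : κ, ∑ k : κ, x k * x j * s i₀ j = ∑ i : κ, ∑ j : κ, x i * x j * s i₀ j :=
          Finset.sum_comm
        rw [e2, ← Finset.sum_sub_distrib, ← Finset.sum_sub_distrib, ← Finset.sum_neg_distrib]
        refine Finset.sum_congr rfl fun i _ => ?_
        rw [← Finset.sum_sub_distrib, ← Finset.sum_sub_distrib, ← Finset.sum_neg_distrib]
        refine Finset.sum_congr rfl fun j _ => ?_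
        ring
      rw [h4] at h3
      linarith
  obtain ⟨B, hB⟩ := CStarAlgebra.nonneg_iff_eq_star_mul_self.1 hPSD.nonneg
  have hcard : Fintype.card κ = Fintype.card ι - 1 := by simp [κ]
  set e := Fintype.equivFinOfCardEq hcard
  set b : ι → Fin (Fintype.card ι - 1) → ℝ := fun i k =>
    if h : i = i₀ then 0 else B (e.symm k) ⟨i, h⟩ with hb
  set g : ι → ι → ℝ := fun i j => (s i i₀ + s i₀ j - s i j) / 2 with hg
  have hin : ∀ i j, b i ⬝ᵥ b j = g i j := by
    intro i j
    by_cases hi : i = i₀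
    · subst hi
      simp [hb, hg, dotProduct, hdiag]
    by_cases hj : j = i₀
    · subst hj
      simp [hb, hg, dotProduct, hdiag]
    have h1 : g i j = Gr ⟨i, hi⟩ ⟨j, hj⟩ := rfl
    rw [h1, hB, Matrix.mul_apply, dotProduct, ← e.symm.sum_comp]
    simp [hb, hi, hj, Matrix.star_apply]
  refine ⟨b, ?_⟩
  ext i j
  rw [hre i j, sqDist, Matrix.of_apply]
  congr 1
  simp only [sub_dotProduct, dotProduct_sub, hin, hg, hdiag, hsymm i₀, hsymm j i]
  ring_nf
  rfl

theorem exists_eq_sqDist_of_norm {H : Type*} [NormedAddCommGroup H] [InnerProductSpace ℝ H]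
    [FiniteDimensional ℝ H] {b : ι → H} (hb : ∀ i j, a i j = ((‖b i - b j‖ ^ 2 : ℝ) : ℂ)) :
    ∃ c : ι → Fin (Module.finrank ℝ H) → ℝ, a = sqDist c := by
  refine ⟨fun i k => (stdOrthonormalBasis ℝ H).repr (b i) k, ?_⟩
  ext i j
  rw [hb, sqDist, Matrix.of_apply]
  congr 1
  rw [← (stdOrthonormalBasis ℝ H).repr.norm_map, EuclideanSpace.real_norm_sq_eq, map_sub]
  simp [dotProduct, sq]

theorem norm_sq_toLp_sub {r : ℕ} (u v : Fin r → ℝ) :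
    ‖(WithLp.toLp 2 u : EuclideanSpace ℝ (Fin r)) - WithLp.toLp 2 v‖ ^ 2 = (u - v) ⬝ᵥ (u - v) := by
  rw [EuclideanSpace.real_norm_sq_eq]
  simp [dotProduct, sq]

theorem IsCNDSymbol.exists_norm_sq (ha : IsCNDSymbol a) (i₀ : ι) :
    ∃ (d : ℕ) (b : ι → EuclideanSpace ℝ (Fin d)), 1 ≤ d ∧
      ∀ i j, a i j = ((‖b i - b j‖ ^ 2 : ℝ) : ℂ) := by
  obtain ⟨b, rfl⟩ := ha.exists_eq_sqDist i₀
  -- A zero coordinate is added so that `1 ≤ d` also when there is a single point.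
  refine ⟨_ + 1, fun i => WithLp.toLp 2 (Fin.cons 0 (b i) : Fin (_ + 1) → ℝ), Nat.le_add_left _ _,
    fun i j => ?_⟩
  rw [norm_sq_toLp_sub, sqDist, Matrix.of_apply]
  simp [dotProduct, Fin.sum_univ_succ]

theorem isSymmetricQMS_of_eq_sqDist {r : ℕ} {b : ι → Fin r → ℝ} (ha : a = sqDist b)
    {M : StarSubalgebra ℂ (Matrix ι ι ℂ)}
    {hM : ∀ (t : ℝ), ∀ x ∈ M, (Matrix.of fun i j => Complex.exp (-t * a i j) * x i j) ∈ M} :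
    IsSymmetricQMS (schurOn a M hM) := by
  subst ha
  exact isSymmetricQMS_schurOn

theorem CBE_and_CGE_of_eq_sqDist {𝓗 : Type*} [NormedAddCommGroup 𝓗] [InnerProductSpace ℂ 𝓗]
    [CompleteSpace 𝓗] (h𝓗 : ¬ FiniteDimensional ℂ 𝓗) {r : ℕ} {b : ι → Fin r → ℝ} (ha : a = sqDist b)
    {M : StarSubalgebra ℂ (Matrix ι ι ℂ)}
    {hM : ∀ (t : ℝ), ∀ x ∈ M, (Matrix.of fun i j => Complex.exp (-t * a i j) * x i j) ∈ M}
    {N : ℝ} (hN : 0 < N) (hr : (r : ℝ) ≤ N) :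
    CBE (schurOn a M hM) 0 N ∧ ∀ Λ : OperatorMean 𝓗, CGE Λ (schurOn a M hM) 0 N := by
  subst ha
  exact ⟨CBE_schurOn hN hr, fun Λ => CGE_schurOn h𝓗 Λ hN hr⟩

end Symbols

/-! ### Length functions and cocycles -/

section Lengths

variable {G : Type*} [Group G] [Fintype G] [DecidableEq G] {ℓ : G → ℝ} {r : ℕ}
  {b : G → Fin r → ℝ}

/-- The symbol involves `g h⁻¹` while the length condition involves `g⁻¹ h`; inverting the labels of
the points reconciles them. -/
theorem herzSchur_symbol_eq_sqDist (hb : ∀ g h, ℓ (g⁻¹ * h) = (b g - b h) ⬝ᵥ (b g - b h)) :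
    (Matrix.of fun g h => (ℓ (g * h⁻¹) : ℂ)) = sqDist fun g => b g⁻¹ := by
  ext g h
  simp only [sqDist, Matrix.of_apply, ← hb, inv_inv]

theorem isCNDLength_of_sqDist (hb : ∀ g h, ℓ (g⁻¹ * h) = (b g - b h) ⬝ᵥ (b g - b h)) :
    IsCNDLength ℓ where
  nonneg g := by
    have h := hb 1 g
    rw [inv_one, one_mul] at h
    rw [h]
    exact Finset.sum_nonneg fun _ _ => mul_self_nonneg _
  one := by simpa using hb 1 1
  inv g := by
    have h1 := hb g 1
    have h2 := hb 1 g
    rw [mul_one] at h1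
    rw [inv_one, one_mul] at h2
    rw [h1, h2, ← neg_sub (b 1), neg_dotProduct, dotProduct_neg, neg_neg]
  cnd α hα := by
    simpa only [sqDist, Matrix.of_apply, ← hb] using (isCNDSymbol_sqDist b).cnd α hα

theorem IsCNDLength.isCNDSymbol (hl : IsCNDLength ℓ) :
    IsCNDSymbol (Matrix.of fun g h => (ℓ (g⁻¹ * h) : ℂ)) where
  diag g := by simp [hl.one]
  symm g h := by
    rw [Matrix.of_apply, Matrix.of_apply, ← hl.inv, mul_inv_rev, inv_inv]
  nonneg g h := by
    rw [Matrix.of_apply]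
    exact_mod_cast hl.nonneg _
  cnd := hl.cnd

theorem IsCNDLength.exists_sqDist (hl : IsCNDLength ℓ) :
    ∃ b : G → Fin (Fintype.card G - 1) → ℝ, ∀ g h, ℓ (g⁻¹ * h) = (b g - b h) ⬝ᵥ (b g - b h) := by
  obtain ⟨b, hb⟩ := hl.isCNDSymbol.exists_eq_sqDist 1
  refine ⟨b, fun g h => ?_⟩
  exact Complex.ofReal_injective (congrFun (congrFun hb g) h)

theorem isSymmetricQMS_herzSchur (hl : IsCNDLength ℓ) : IsSymmetricQMS (herzSchurSemigroup ℓ) := by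
  obtain ⟨b, hb⟩ := hl.exists_sqDist
  exact isSymmetricQMS_of_eq_sqDist (herzSchur_symbol_eq_sqDist hb)

theorem CBE_and_CGE_herzSchur {𝓗 : Type*} [NormedAddCommGroup 𝓗] [InnerProductSpace ℂ 𝓗]
    [CompleteSpace 𝓗] (h𝓗 : ¬ FiniteDimensional ℂ 𝓗)
    (hb : ∀ g h, ℓ (g⁻¹ * h) = (b g - b h) ⬝ᵥ (b g - b h)) {N : ℝ} (hN : 0 < N) (hr : (r : ℝ) ≤ N) :
    CBE (herzSchurSemigroup ℓ) 0 N ∧ ∀ Λ : OperatorMean 𝓗, CGE Λ (herzSchurSemigroup ℓ) 0 N :=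
  CBE_and_CGE_of_eq_sqDist h𝓗 (herzSchur_symbol_eq_sqDist hb) hN hr

/-- The cocycle identity gives `b h - b g = π g (b (g⁻¹ h))`, and `π g` is isometric. -/
theorem IsCocycleOf.exists_sqDist {H : Type*} [NormedAddCommGroup H] [InnerProductSpace ℝ H]
    [FiniteDimensional ℝ H] {π : G →* (H ≃ₗᵢ[ℝ] H)} {b : G → H} (hc : IsCocycleOf ℓ π b) :
    ∃ c : G → Fin (Module.finrank ℝ H) → ℝ,
      ∀ g h, ℓ (g⁻¹ * h) = (c g - c h) ⬝ᵥ (c g - c h) := by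
  have h1 : ∀ g h, (Matrix.of fun g h => (ℓ (g⁻¹ * h) : ℂ)) g h
      = ((‖b g - b h‖ ^ 2 : ℝ) : ℂ) := by
    intro g h
    rw [Matrix.of_apply, hc.length, norm_sub_rev, ← (π g).norm_map]
    have h2 := hc.cocycle g (g⁻¹ * h)
    rw [mul_inv_cancel_left] at h2
    rw [h2, add_sub_cancel_left]
  obtain ⟨c, hc'⟩ := exists_eq_sqDist_of_norm h1
  exact ⟨c, fun g h => Complex.ofReal_injective (congrFun (congrFun hc' g) h)⟩

/-- Equal Gram matrices give equal norms to corresponding linear combinations, so any linear section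
of the combinations of `u` induces the isometry, independently of the section. -/
theorem exists_linearIsometry_of_inner_eq {κ E F : Type*} [Fintype κ]
    [NormedAddCommGroup E] [InnerProductSpace ℝ E] [NormedAddCommGroup F] [InnerProductSpace ℝ F]
    {u : κ → E} {w : κ → F} (h : ∀ i j, inner ℝ (u i) (u j) = inner ℝ (w i) (w j))
    (hu : Submodule.span ℝ (Set.range u) = ⊤) : ∃ f : E →ₗᵢ[ℝ] F, ∀ i, f (u i) = w i := by
  classical
  have hnorm : ∀ α : κ → ℝ,
      ‖Fintype.linearCombination ℝ w α‖ = ‖Fintype.linearCombination ℝ u α‖ := by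
    intro α
    rw [← sq_eq_sq₀ (norm_nonneg _) (norm_nonneg _), ← real_inner_self_eq_norm_sq,
      ← real_inner_self_eq_norm_sq]
    simp only [Fintype.linearCombination_apply, sum_inner, inner_sum, inner_smul_left,
      inner_smul_right, h]
  obtain ⟨g, hg⟩ := (Fintype.linearCombination ℝ u).exists_rightInverse_of_surjective
    (by rw [Fintype.range_linearCombination, hu])
  have hg' : ∀ x, Fintype.linearCombination ℝ u (g x) = x := fun x => LinearMap.congr_fun hg x
  refine ⟨⟨Fintype.linearCombination ℝ w ∘ₗ g, fun x => ?_⟩, fun i => ?_⟩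
  · rw [LinearMap.comp_apply, hnorm, hg']
  · show Fintype.linearCombination ℝ w (g (u i)) = w i
    have h1 := hnorm (g (u i) - Pi.single i 1)
    rw [map_sub, map_sub, hg', Fintype.linearCombination_apply_single,
      Fintype.linearCombination_apply_single, one_smul, one_smul, sub_self, norm_zero,
      norm_eq_zero, sub_eq_zero] at h1
    exact h1

/-- Left translation by `k` preserves the distances between the points. Moving the image of the
origin back by `u k` makes it linear, `u g ↦ u (k g) - u k`; spanning makes it unique, hence
multiplicative in `k`. -/
theorem exists_cocycle_of_span_eq_top {d : ℕ} {u : G → EuclideanSpace ℝ (Fin d)} (hu1 : u 1 = 0)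
    (hu : ∀ g h, ℓ (g⁻¹ * h) = ‖u g - u h‖ ^ 2) (hspan : Submodule.span ℝ (Set.range u) = ⊤) :
    ∃ π : G →* (EuclideanSpace ℝ (Fin d) ≃ₗᵢ[ℝ] EuclideanSpace ℝ (Fin d)),
      IsCocycleOf ℓ π u := by
  have hlen : ∀ g, ℓ g = ‖u g‖ ^ 2 := fun g => by
    have h := hu 1 g
    rwa [inv_one, one_mul, hu1, zero_sub, norm_neg] at h
  have hinner : ∀ k g h, inner ℝ (u g) (u h) = inner ℝ (u (k * g) - u k) (u (k * h) - u k) := by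
    intro k g h
    have e : ∀ g h, ‖u (k * g) - u (k * h)‖ ^ 2 = ‖u g - u h‖ ^ 2 := fun g h => by
      rw [← hu, ← hu]
      congr 1
      group
    have e0 : ∀ g, ‖u (k * g) - u k‖ ^ 2 = ‖u g‖ ^ 2 := fun g => by
      simpa [hu1] using e g 1
    rw [real_inner_eq_norm_mul_self_add_norm_mul_self_sub_norm_sub_mul_self_div_two,
      real_inner_eq_norm_mul_self_add_norm_mul_self_sub_norm_sub_mul_self_div_two,
      sub_sub_sub_cancel_right]
    simp only [← sq, e, e0]
  choose f hf using fun k => exists_linearIsometry_of_inner_eq (hinner k) hspan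
  refine ⟨MonoidHom.mk' (fun k => (f k).toLinearIsometryEquiv rfl) fun k l => ?_,
    fun g h => ?_, hlen⟩
  · have h1 : (f (k * l)).toLinearMap = (f k).toLinearMap ∘ₗ (f l).toLinearMap := by
      refine LinearMap.ext_on_range hspan fun g => ?_
      show f (k * l) (u g) = f k (f l (u g))
      rw [hf, hf, map_sub, hf, hf, mul_assoc, sub_sub_sub_cancel_right]
    ext1 x
    exact LinearMap.congr_fun h1 x
  · show u (g * h) = u g + f g (u h)
    rw [hf, add_sub_cancel]

theorem IsCNDLength.exists_cocycle (hl : IsCNDLength ℓ) :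
    ∃ (d : ℕ) (π : G →* (EuclideanSpace ℝ (Fin d) ≃ₗᵢ[ℝ] EuclideanSpace ℝ (Fin d)))
      (b : G → EuclideanSpace ℝ (Fin d)), d ≤ Fintype.card G - 1 ∧ IsCocycleOf ℓ π b := by
  obtain ⟨b, hb⟩ := hl.exists_sqDist
  set β : G → EuclideanSpace ℝ (Fin (Fintype.card G - 1)) := fun g =>
    WithLp.toLp 2 (b g) - WithLp.toLp 2 (b 1) with hβ
  -- Restricting to the span can only lower the dimension, and makes the linear parts of the
  -- translations unique.
  set S := Submodule.span ℝ (Set.range β)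
  set γ : G → S := fun g => ⟨β g, Submodule.subset_span ⟨g, rfl⟩⟩ with hγ
  have hγS : Submodule.span ℝ (Set.range γ) = ⊤ := by
    refine Submodule.map_injective_of_injective S.injective_subtype ?_
    rw [Submodule.map_span, ← Set.range_comp, Submodule.map_top, Submodule.range_subtype]
    rfl
  set e := (stdOrthonormalBasis ℝ S).repr
  have hspan : Submodule.span ℝ (Set.range fun g => e (γ g)) = ⊤ := by
    have h1 : Set.range (fun g => e (γ g)) = e.toLinearEquiv.toLinearMap '' Set.range γ := by
      rw [← Set.range_comp]
      rfl
    rw [h1, ← Submodule.map_span, hγS, Submodule.map_top, LinearEquiv.range]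
  obtain ⟨π, hπ⟩ := exists_cocycle_of_span_eq_top (ℓ := ℓ) (u := fun g => e (γ g))
    (by
      have h1 : γ 1 = 0 := Subtype.ext (sub_self _)
      simp only [h1, map_zero])
    (fun g h => by
      have h1 : ‖γ g - γ h‖ = ‖β g - β h‖ := rfl
      rw [hb, ← map_sub, e.norm_map, h1, hβ]
      simp only [sub_sub_sub_cancel_right, norm_sq_toLp_sub]) hspan
  refine ⟨_, π, _, ?_, hπ⟩
  exact (Submodule.finrank_le S).trans (by simp)

end Lengths

/-! ### Cyclic groups -/

section Cyclic

/-- The vertices of an even cycle, isometrically embedded into the `m`-dimensional cube. -/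
noncomputable def cycleEmb (m k : ℕ) (j : ℕ) : ℝ := if j < k ∧ k ≤ j + m then 1 else 0

/-- Along the cycle, coordinate `j` switches on between `j` and `j + 1` and off between `j + m` and
`j + m + 1`. Each step flips one coordinate and antipodal steps flip the same one, so Hamming
distance in the cube is distance in the cycle. -/
theorem sum_cycleEmb_sub_sq {m k l : ℕ} (hk : k < 2 * m) (hl : l < 2 * m) :
    ∑ j ∈ Finset.range m, (cycleEmb m k j - cycleEmb m l j) * (cycleEmb m k j - cycleEmb m l j)
      = (min ((k - l) + (l - k)) (2 * m - ((k - l) + (l - k))) : ℕ) := by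
  have hA : ∀ k, k < 2 * m → ∑ j ∈ Finset.range m, cycleEmb m k j
      = ((min k m - (k - m) : ℕ) : ℝ) := by
    intro k hk
    simp only [cycleEmb]
    rw [Finset.sum_boole, ← Nat.card_Ico]
    congr 2
    ext j
    simp only [Finset.mem_filter, Finset.mem_range, Finset.mem_Ico]
    omega
  have hB : ∑ j ∈ Finset.range m, cycleEmb m k j * cycleEmb m l j
      = ((min (min k m) (min l m) - max (k - m) (l - m) : ℕ) : ℝ) := by
    simp only [cycleEmb, ← ite_and, mul_ite, mul_one, mul_zero]
    rw [Finset.sum_boole, ← Nat.card_Ico]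
    congr 2
    ext j
    simp only [Finset.mem_filter, Finset.mem_range, Finset.mem_Ico]
    omega
  have hC : ∀ j, (cycleEmb m k j - cycleEmb m l j) * (cycleEmb m k j - cycleEmb m l j)
      = cycleEmb m k j + cycleEmb m l j - 2 * (cycleEmb m k j * cycleEmb m l j) := by
    intro j
    simp only [cycleEmb]
    split_ifs <;> norm_num
  simp only [hC, Finset.sum_sub_distrib, Finset.sum_add_distrib, ← Finset.mul_sum, hA k hk, hA l hl,
    hB]
  rw [sub_eq_iff_eq_add]
  norm_cast
  omega

theorem min_val_sub {n : ℕ} [NeZero n] (x y : ZMod n) :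
    min (-x + y).val (n - (-x + y).val)
      = min ((x.val - y.val) + (y.val - x.val)) (n - ((x.val - y.val) + (y.val - x.val))) := by
  have hx := x.val_lt
  have hy := y.val_lt
  rcases le_total x.val y.val with h | h
  · rw [neg_add_eq_sub, ZMod.val_sub h]
    omega
  · rw [neg_add_eq_sub, ← neg_sub, ZMod.neg_val]
    split_ifs with h0
    · rw [sub_eq_zero.1 h0]
      simp
    · rw [ZMod.val_sub h]
      omega

theorem wordLength_eq_sqDist {n : ℕ} [NeZero n] {m : ℕ} (hn : n = 2 * m)
    (g h : Multiplicative (ZMod n)) :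
    wordLength n (g⁻¹ * h)
      = ((fun j : Fin m => cycleEmb m g.toAdd.val j) - fun j : Fin m => cycleEmb m h.toAdd.val j) ⬝ᵥ
        ((fun j : Fin m => cycleEmb m g.toAdd.val j) - fun j : Fin m => cycleEmb m h.toAdd.val j) := by
  have hg : g.toAdd.val < 2 * m := hn ▸ g.toAdd.val_lt
  have hh : h.toAdd.val < 2 * m := hn ▸ h.toAdd.val_lt
  rw [wordLength, toAdd_mul, toAdd_inv, min_val_sub]
  simp only [dotProduct, Pi.sub_apply]
  rw [Fin.sum_univ_eq_sum_range (fun j => (cycleEmb m g.toAdd.val j - cycleEmb m h.toAdd.val j)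
    * (cycleEmb m g.toAdd.val j - cycleEmb m h.toAdd.val j)), sum_cycleEmb_sub_sq hg hh, ← hn]

end Cyclic

/-! ### Symmetric groups -/

section Perms

/-- The permutation matrix of `σ`, divided by `√2`, as a vector. -/
noncomputable def permVec {n : ℕ} (σ : Equiv.Perm (Fin n)) (p : Fin (n * n)) : ℝ :=
  if σ (finProdFinEquiv.symm p).1 = (finProdFinEquiv.symm p).2 then (√2)⁻¹ else 0

/-- In each row where the permutations disagree, their matrices differ in exactly two entries; the
factor `1/√2` makes such a row count once. -/
theorem hammingLength_eq_sqDist {n : ℕ} (σ τ : Equiv.Perm (Fin n)) :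
    hammingLength n (σ⁻¹ * τ) = (permVec σ - permVec τ) ⬝ᵥ (permVec σ - permVec τ) := by
  have h2 : (√2 : ℝ)⁻¹ * (√2)⁻¹ = 2⁻¹ := by
    rw [← mul_inv, Real.mul_self_sqrt (by norm_num)]
  simp only [dotProduct, Pi.sub_apply, permVec]
  rw [finProdFinEquiv.symm.sum_comp (fun p : Fin n × Fin n =>
    ((if σ p.1 = p.2 then (√2 : ℝ)⁻¹ else 0) - if τ p.1 = p.2 then (√2 : ℝ)⁻¹ else 0)
    * ((if σ p.1 = p.2 then (√2 : ℝ)⁻¹ else 0) - if τ p.1 = p.2 then (√2 : ℝ)⁻¹ else 0)),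
    Fintype.sum_prod_type, hammingLength, ← Finset.sum_boole]
  refine Finset.sum_congr rfl fun j _ => ?_
  have h3 : (σ⁻¹ * τ) j ≠ j ↔ ¬ τ j = σ j := by
    rw [Equiv.Perm.mul_apply, Ne, Equiv.Perm.inv_eq_iff_eq]
  simp only [h3, sub_mul, mul_sub, ite_mul, mul_ite, zero_mul, mul_zero, h2,
    Finset.sum_sub_distrib, Finset.sum_ite_eq, Finset.mem_univ, if_true]
  split_ifs with h4 h5 <;> norm_num
  all_goals simp_all

end Perms

end QMarkov


theorem mainTheorem12 {𝓗 : Type*} [NormedAddCommGroup 𝓗] [InnerProductSpace ℂ 𝓗]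
    [CompleteSpace 𝓗] (h𝓗 : ¬ FiniteDimensional ℂ 𝓗) :
    -- Schur multipliers over matrix algebras
    (∀ (n : ℕ), 1 ≤ n → ∀ a : Matrix (Fin n) (Fin n) ℂ,
      (IsSymmetricQMS (schurSemigroup a) ↔ IsCNDSymbol a) ∧
      (IsCNDSymbol a →
        (∃ (d : ℕ) (b : Fin n → EuclideanSpace ℝ (Fin d)), 1 ≤ d ∧
          ∀ i j, a i j = ((‖b i - b j‖ ^ 2 : ℝ) : ℂ)) ∧
        ∀ (d : ℕ), 1 ≤ d → ∀ (H : Type*) [NormedAddCommGroup H] [InnerProductSpace ℝ H],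
          Module.finrank ℝ H = d → ∀ b : Fin n → H,
          (∀ i j, a i j = ((‖b i - b j‖ ^ 2 : ℝ) : ℂ)) →
          CBE (schurSemigroup a) 0 d ∧
          ∀ Λ : OperatorMean 𝓗, CGE Λ (schurSemigroup a) 0 d)) ∧
    -- Herz–Schur multipliers over group algebras of finite groups
    (∀ (G : Type*) [Group G] [Fintype G] [DecidableEq G] (ℓ : G → ℝ), IsCNDLength ℓ →
      IsSymmetricQMS (herzSchurSemigroup ℓ) ∧
      (∃ (d : ℕ) (π : G →* (EuclideanSpace ℝ (Fin d) ≃ₗᵢ[ℝ] EuclideanSpace ℝ (Fin d)))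
        (b : G → EuclideanSpace ℝ (Fin d)), d ≤ Fintype.card G - 1 ∧ IsCocycleOf ℓ π b) ∧
      ∀ (d : ℕ), 1 ≤ d → ∀ (H : Type*) [NormedAddCommGroup H] [InnerProductSpace ℝ H],
        Module.finrank ℝ H = d → ∀ (π : G →* (H ≃ₗᵢ[ℝ] H)) (b : G → H), IsCocycleOf ℓ π b →
        CBE (herzSchurSemigroup ℓ) 0 d ∧
        ∀ Λ : OperatorMean 𝓗, CGE Λ (herzSchurSemigroup ℓ) 0 d) ∧
    -- cyclic groups of even order with the word length
    (∀ (n : ℕ) [NeZero n], Even n →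
      IsCNDLength (wordLength n) ∧
      CBE (herzSchurSemigroup (wordLength n)) 0 ((n : ℝ) / 2) ∧
      ∀ Λ : OperatorMean 𝓗, CGE Λ (herzSchurSemigroup (wordLength n)) 0 ((n : ℝ) / 2)) ∧
    -- symmetric groups with the Hamming length
    (∀ (n : ℕ), 2 ≤ n →
      IsCNDLength (hammingLength n) ∧
      CBE (herzSchurSemigroup (hammingLength n)) 0 (min (n.factorial - 1) (n ^ 2) : ℕ) ∧
      ∀ Λ : OperatorMean 𝓗,
        CGE Λ (herzSchurSemigroup (hammingLength n)) 0 (min (n.factorial - 1) (n ^ 2) : ℕ)) := by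
  refine ⟨fun n hn a => ⟨⟨isCNDSymbol_of_isSymmetricQMS, fun ha => ?_⟩, fun ha => ⟨?_, ?_⟩⟩,
    fun G _ _ _ ℓ hl => ⟨isSymmetricQMS_herzSchur hl, hl.exists_cocycle, ?_⟩,
    fun n _ hn => ?_, fun n hn => ?_⟩
  · obtain ⟨b, hb⟩ := ha.exists_eq_sqDist ⟨0, hn⟩
    exact isSymmetricQMS_of_eq_sqDist hb
  · exact ha.exists_norm_sq ⟨0, hn⟩
  · intro d hd H _ _ hH b hb
    have : FiniteDimensional ℝ H := Module.finite_of_finrank_pos (by omega)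
    obtain ⟨c, hc⟩ := exists_eq_sqDist_of_norm hb
    exact CBE_and_CGE_of_eq_sqDist h𝓗 hc (by exact_mod_cast hd) (by rw [hH])
  · intro d hd H _ _ hH π b hb
    have : FiniteDimensional ℝ H := Module.finite_of_finrank_pos (by omega)
    obtain ⟨c, hc⟩ := hb.exists_sqDist
    exact CBE_and_CGE_herzSchur h𝓗 hc (by exact_mod_cast hd) (by rw [hH])
  · obtain ⟨m, hm⟩ := hn
    have hm2 : n = 2 * m := by omega
    have hpos : 0 < n := Nat.pos_of_neZero n
    have hnm : (n : ℝ) / 2 = m := by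
      rw [hm2]
      push_cast
      ring
    refine ⟨isCNDLength_of_sqDist (wordLength_eq_sqDist hm2),
      CBE_and_CGE_herzSchur h𝓗 (wordLength_eq_sqDist hm2) ?_ hnm.ge⟩
    have : (0 : ℝ) < n := by exact_mod_cast hpos
    linarith
  · have hl : IsCNDLength (hammingLength n) := isCNDLength_of_sqDist hammingLength_eq_sqDist
    have hfac : 2 ≤ n.factorial := hn.trans n.self_le_factorial
    have hN : (0 : ℝ) < (min (n.factorial - 1) (n ^ 2) : ℕ) := by
      have : 0 < n ^ 2 := by positivity
      exact_mod_cast lt_min (by omega) this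
    refine ⟨hl, ?_⟩
    -- Two embeddings compete: Schoenberg's in dimension `|S_n| - 1` and the permutation matrices in
    -- dimension `n²`.
    rcases le_total (n.factorial - 1) (n ^ 2) with h | h
    · obtain ⟨b, hb⟩ := hl.exists_sqDist
      refine CBE_and_CGE_herzSchur h𝓗 hb hN ?_
      rw [min_eq_left h, Fintype.card_perm, Fintype.card_fin]
    · refine CBE_and_CGE_herzSchur h𝓗 hammingLength_eq_sqDist hN ?_
      rw [min_eq_right h, sq]
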